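/- An *alignment* is a pair $(R,t)$ of a rotation matrix $R\in\mathbb{R}^{2\times 2}$ ($R^TR=I$, $\det R=1$) and a vector $t\in\mathbb{R}^2$. For a point $q$ and a line $\ell$ in the plane, $\mathrm{dist}(q,\ell)=\min_{x\in\ell}\|q-x\|_2$. Let $J=\begin{pmatrix}0&-1\\1&0\end{pmatrix}$. **Z-Configs.** For $w=(w_x,w_y)$ with $w_y\ne 0$ and $p,q,z\in\mathbb{R}^2$ put $r_1=\|p-q\|$, $r_2=\|p-z\|$, $r_3=\|q-z\|$, $P=r_1\begin{pmatrix}w_x/w_y&1\\0&0\end{pmatrix}$, $Q=P^T$. If $p\ne q$, put $d_1=\frac{r_1^2+r_2^2-r_3^2}{2r_1}$, $d_2=\sqrt{|r_2^2-d_1^2|}$, $\beta=1$ if $(z-p)^TJ(q-p)>0$ and $\beta=-1$ otherwise, and $Z=P+\frac{d_1}{r_1}(Q-P)+\beta\frac{d_2}{r_1}J(Q-P)$. If $p=q$, put $Z=r_2I$. The result is $(P,Q,Z)$. **Align.** The input is $A=((p_1,\ell_1),\dots,(p_n,\ell_n))$, where each $p_i$ is a point and each $\ell_i$ a line in the plane.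 Write $\ell_i=\{q: v_i^Tq=b_i\}$ with $\|v_i\|=1$ and $b_i\ge 0$, and let $u_i=-Jv_i$, a unit direction vector of $\ell_i$. For all $j,k,l\in\{1,\dots,n\}$ with $j\ne k$: * If $|v_j^Tv_k|\neq 1$, let $R_j$ be the rotation matrix with rows $u_j^T$, $v_j^T$, let $(P',Q',Z')$ be the result of Z-Configs on $(R_ju_k,p_j,p_k,p_l)$, let $(P,Q,Z)=(R_j^TP',R_j^TQ',R_j^TZ')$, let $s$ be the common point of $\ell_j$ and $\ell_k$, $c_l=b_l-v_l^Ts$, and $X=\arg\min_{\|x\|=1}|v_l^TZx-c_l|$. Let $F$ be the set of alignments $(R,t)$ for which some $x\in X$ satisfies $Rp_j-t=s+Px$, $Rp_k-t=s+Qx$ and $Rp_l-t=s+Zx$. If $F$ is finite, all its elements are chosen, otherwise one arbitrary element of it. * If $|v_j^Tv_k|=1$, let $F$ be the set of alignments $(R,t)$ that minimize $\mathrm{dist}(Rp_k-t,\ell_k)$ among the alignments with $Rp_j-t\in\ell_j$. If only finitely many rotations occur in $F$, one arbitrary $(R,t)\in F$ is chosen for each of these rotations $R$; otherwise one arbitrary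 element of $F$ is chosen. The output of Align$(A)$ is the set $C$ of all the chosen alignments. **Lemma.** Let $n\ge 3$ and let $C$ be an output of Align$(A)$ on $n$ point–line pairs. Then for every alignment $(R^*,t^*)$ there is $(R,t)\in C$ such that $$\mathrm{dist}(Rp_i-t,\ell_i)\le 16\cdot\mathrm{dist}(R^*p_i-t^*,\ell_i)\qquad\text{for every } i\in\{1,\dots,n\}.$$ Moreover $|C|\in O(n^3)$, and an output of Align$(A)$ can be computed in $O(n^3)$ time: there are an absolute constant $K$ and one program of a real RAM (unit-cost $+,-$ and comparison of integers; unit-cost $+,-,\times,/,\sqrt{\ }$ and comparison of real numbers; indirect addressing) such that always $|C|\le Kn^3$, and for all $n\ge 3$ and every such $A$, given by the coordinates of the $p_i$ and the coefficients of an equation of each $\ell_i$, the program halts after at most $Kn^3$ steps with a list of the elements of an output of Align$(A)$. -/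

import Mathlib

open scoped Matrix

noncomputable section

namespace PointsToLines

/-! ### Geometry of the plane -/

/-- The Euclidean plane. -/
abbrev Plane : Type := EuclideanSpace ℝ (Fin 2)

/-- A line in the plane. -/
def IsLine (ℓ : AffineSubspace ℝ Plane) : Prop :=
  Module.finrank ℝ ℓ.direction = 1

/-- The matrix-vector product, as a map of the Euclidean plane. -/
def act (M : Matrix (Fin 2) (Fin 2) ℝ) (x : Plane) : Plane :=
  WithLp.toLp 2 (M *ᵥ WithLp.ofLp x)

/-- An alignment `(R, t)`: a rotation matrix (orthogonal, of determinant `1`) and a translation. -/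
abbrev Alignment : Type := Matrix.specialOrthogonalGroup (Fin 2) ℝ × Plane

/-- The image `R p - t` of the point `p` under the alignment `(R, t)`. -/
def Alignment.app (a : Alignment) (p : Plane) : Plane :=
  act (a.1 : Matrix (Fin 2) (Fin 2) ℝ) p - a.2

/-- The Euclidean distance from a point to a line. -/
def lineDist (q : Plane) (ℓ : AffineSubspace ℝ Plane) : ℝ :=
  Metric.infDist q (ℓ : Set Plane)

/-- The rotation by `π / 2` counter-clockwise. -/
def J : Matrix (Fin 2) (Fin 2) ℝ := !![0, -1; 1, 0]

/-! ### The sub-routine Z-Configs -/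

/-- `zConfigs w p q z = (P, Q, Z)` for a direction `w` that is not horizontal. As `x` runs over the
unit vectors, `(P x, Q x, Z x)` runs over the images of the triangle `(p, q, z)` under a rotation
and a translation that take `p` to the horizontal axis and `q` to the line spanned by `w`.
If `p = q`, both are taken to the origin, and `z` runs over a circle. -/
def zConfigs (w p q z : Plane) :
    Matrix (Fin 2) (Fin 2) ℝ × Matrix (Fin 2) (Fin 2) ℝ × Matrix (Fin 2) (Fin 2) ℝ :=
  let r₁ := ‖p - q‖
  let r₂ := ‖p - z‖
  let r₃ := ‖q - z‖
  let d₁ := (r₁ ^ 2 + r₂ ^ 2 - r₃ ^ 2) / (2 * r₁)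
  let d₂ := Real.sqrt |r₂ ^ 2 - d₁ ^ 2|
  let P : Matrix (Fin 2) (Fin 2) ℝ := r₁ • !![w 0 / w 1, 1; 0, 0]
  let Q : Matrix (Fin 2) (Fin 2) ℝ := Pᵀ
  let b : ℝ := open Classical in if 0 < inner ℝ (z - p) (act J (q - p)) then 1 else -1
  let Z : Matrix (Fin 2) (Fin 2) ℝ :=
    open Classical in
    if p = q then r₂ • (1 : Matrix (Fin 2) (Fin 2) ℝ)
    else P + (d₁ / r₁) • (Q - P) + (b * (d₂ / r₁)) • (J * (Q - P))
  (P, Q, Z)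

/-! ### The algorithm Align -/

/-- The lines `ℓ i` are written as `{q | ⟪v i, q⟫ = b i}` with a unit normal `v i` and `b i ≥ 0`. -/
def IsNormalForm {n : ℕ} (ℓ : Fin n → AffineSubspace ℝ Plane) (v : Fin n → Plane)
    (b : Fin n → ℝ) : Prop :=
  ∀ i, ‖v i‖ = 1 ∧ 0 ≤ b i ∧ (ℓ i : Set Plane) = {q | inner ℝ (v i) q = b i}

/-- The unit vector `u` with `J u = v`: a direction of a line with unit normal `v`. -/
def dirOf (v : Plane) : Plane := act (-J) v

/-- The rotation matrix with rows `dirOf v` and `v`; it takes the direction of a line with unit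
normal `v` to the horizontal axis. -/
def rotOf (v : Plane) : Matrix (Fin 2) (Fin 2) ℝ :=
  !![dirOf v 0, dirOf v 1; v 0, v 1]

/-- The alignments found for a triple `(j, k, l)` with `ℓ j`, `ℓ k` not parallel: those that take
`(p j, p k, p l)` to `(s + P x, s + Q x, s + Z x)`, where `s` is the common point of `ℓ j`, `ℓ k` and
`x` is a unit vector that minimizes the distance `|⟪v l, s + Z x⟫ - b l|` of `s + Z x` from `ℓ l`. -/
def crossing {n : ℕ} (p : Fin n → Plane) (ℓ : Fin n → AffineSubspace ℝ Plane) (v : Fin n → Plane)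
    (b : Fin n → ℝ) (j k l : Fin n) : Set Alignment :=
  let PQZ := zConfigs (act (rotOf (v j)) (dirOf (v k))) (p j) (p k) (p l)
  let P := (rotOf (v j))ᵀ * PQZ.1
  let Q := (rotOf (v j))ᵀ * PQZ.2.1
  let Z := (rotOf (v j))ᵀ * PQZ.2.2
  {a | ∃ s x : Plane, s ∈ ℓ j ∧ s ∈ ℓ k ∧ ‖x‖ = 1 ∧
    (∀ y : Plane, ‖y‖ = 1 →
      |inner ℝ (v l) (act Z x) - (b l - inner ℝ (v l) s)| ≤
        |inner ℝ (v l) (act Z y) - (b l - inner ℝ (v l) s)|) ∧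
    a.app (p j) = s + act P x ∧ a.app (p k) = s + act Q x ∧ a.app (p l) = s + act Z x}

/-- The alignments for a pair `(j, k)` with parallel lines: among those that put `p j` on `ℓ j`, the
ones that bring `p k` as close to `ℓ k` as possible. -/
def sliding {n : ℕ} (p : Fin n → Plane) (ℓ : Fin n → AffineSubspace ℝ Plane) (j k : Fin n) :
    Set Alignment :=
  {a | a.app (p j) ∈ ℓ j ∧
    ∀ a' : Alignment, a'.app (p j) ∈ ℓ j →
      lineDist (a.app (p k)) (ℓ k) ≤ lineDist (a'.app (p k)) (ℓ k)}

/-- `S` is all of `F` if `F` is finite, and an arbitrary element of `F` otherwise. -/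
def IsSelection (F S : Set Alignment) : Prop :=
  (F.Finite ∧ S = F) ∨ (F.Infinite ∧ ∃ a ∈ F, S = {a})

/-- `S` has one (arbitrary) element of `F` for every rotation that occurs in `F` if these are
finitely many, and is an arbitrary element of `F` otherwise. -/
def IsSelectionPerRotation (F S : Set Alignment) : Prop :=
  ((Prod.fst '' F).Finite ∧ S ⊆ F ∧ ∀ R ∈ Prod.fst '' F, ∃! t : Plane, ((R, t) : Alignment) ∈ S) ∨
    ((Prod.fst '' F).Infinite ∧ ∃ a ∈ F, S = {a})

/-- `C` is a possible output of Align on the pairs `(p i, ℓ i)`: a union over all triples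
`(j, k, l)` with `j ≠ k` of the alignments chosen for that triple. -/
def IsAlignOutput {n : ℕ} (p : Fin n → Plane) (ℓ : Fin n → AffineSubspace ℝ Plane)
    (C : Set Alignment) : Prop :=
  ∃ (v : Fin n → Plane) (b : Fin n → ℝ) (S : Fin n → Fin n → Fin n → Set Alignment),
    IsNormalForm ℓ v b ∧
    (∀ j k l, j ≠ k → |inner ℝ (v j) (v k)| ≠ 1 → IsSelection (crossing p ℓ v b j k l) (S j k l)) ∧
    (∀ j k l, j ≠ k → |inner ℝ (v j) (v k)| = 1 →
      IsSelectionPerRotation (sliding p ℓ j k) (S j k l)) ∧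
    C = {a | ∃ j k l, j ≠ k ∧ a ∈ S j k l}

/-! ### Running time: the real RAM -/

/-- States of the real RAM: integer registers, real registers, and a memory of real cells. -/
structure State where
  nat : ℕ → ℕ
  real : ℕ → ℝ
  mem : ℕ → ℝ

/-- Integer expressions; the difference is truncated at `0`. -/
inductive NExp where
  | const (c : ℕ)
  | var (i : ℕ)
  | add (e f : NExp)
  | sub (e f : NExp)

def NExp.eval (σ : State) : NExp → ℕ
  | .const c => c
  | .var i => σ.nat i
  | .add e f => e.eval σ + f.eval σ
  | .sub e f => e.eval σ - f.eval σ

/-- The number of elementary operations of an evaluation. -/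
def NExp.cost : NExp → ℕ
  | .const _ => 1
  | .var _ => 1
  | .add e f => e.cost + f.cost + 1
  | .sub e f => e.cost + f.cost + 1

/-- Real expressions. `load e` reads the memory cell with address `e`. -/
inductive RExp where
  | const (c : ℤ)
  | var (i : ℕ)
  | load (e : NExp)
  | add (e f : RExp)
  | sub (e f : RExp)
  | mul (e f : RExp)
  | div (e f : RExp)
  | sqrt (e : RExp)

def RExp.eval (σ : State) : RExp → ℝ
  | .const c => c
  | .var i => σ.real i
  | .load e => σ.mem (e.eval σ)
  | .add e f => e.eval σ + f.eval σ
  | .sub e f => e.eval σ - f.eval σ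
  | .mul e f => e.eval σ * f.eval σ
  | .div e f => e.eval σ / f.eval σ
  | .sqrt e => Real.sqrt (e.eval σ)

def RExp.cost : RExp → ℕ
  | .const _ => 1
  | .var _ => 1
  | .load e => e.cost + 1
  | .add e f => e.cost + f.cost + 1
  | .sub e f => e.cost + f.cost + 1
  | .mul e f => e.cost + f.cost + 1
  | .div e f => e.cost + f.cost + 1
  | .sqrt e => e.cost + 1

/-- Tests. -/
inductive BExp where
  | natLt (e f : NExp)
  | realLt (e f : RExp)
  | not (c : BExp)
  | and (c d : BExp)

def BExp.holds (σ : State) : BExp → Prop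
  | .natLt e f => e.eval σ < f.eval σ
  | .realLt e f => e.eval σ < f.eval σ
  | .not c => ¬ c.holds σ
  | .and c d => c.holds σ ∧ d.holds σ

def BExp.cost : BExp → ℕ
  | .natLt e f => e.cost + f.cost + 1
  | .realLt e f => e.cost + f.cost + 1
  | .not c => c.cost + 1
  | .and c d => c.cost + d.cost + 1

/-- Programs of the real RAM. -/
inductive Prog where
  | skip
  | setNat (i : ℕ) (e : NExp)
  | setReal (i : ℕ) (e : RExp)
  | store (addr : NExp) (e : RExp)
  | seq (c d : Prog)
  | cond (t : BExp) (c d : Prog)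
  | loop (t : BExp) (c : Prog)

/-- `Exec c σ k σ'`: the program `c`, started in the state `σ`, halts in the state `σ'` after `k`
elementary steps. `loop t c` repeats `c` as long as the test `t` holds. -/
inductive Exec : Prog → State → ℕ → State → Prop where
  | skip (σ : State) : Exec .skip σ 1 σ
  | setNat (i : ℕ) (e : NExp) (σ : State) :
      Exec (.setNat i e) σ (e.cost + 1) { σ with nat := Function.update σ.nat i (e.eval σ) }
  | setReal (i : ℕ) (e : RExp) (σ : State) :
      Exec (.setReal i e) σ (e.cost + 1) { σ with real := Function.update σ.real i (e.eval σ) }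
  | store (addr : NExp) (e : RExp) (σ : State) :
      Exec (.store addr e) σ (addr.cost + e.cost + 1)
        { σ with mem := Function.update σ.mem (addr.eval σ) (e.eval σ) }
  | seq {c d : Prog} {σ τ υ : State} {k m : ℕ} (h₁ : Exec c σ k τ) (h₂ : Exec d τ m υ) :
      Exec (.seq c d) σ (k + m) υ
  | condTrue {t : BExp} {c d : Prog} {σ τ : State} {k : ℕ} (ht : t.holds σ) (h : Exec c σ k τ) :
      Exec (.cond t c d) σ (t.cost + k) τ
  | condFalse {t : BExp} {c d : Prog} {σ τ : State} {k : ℕ} (ht : ¬ t.holds σ)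
      (h : Exec d σ k τ) : Exec (.cond t c d) σ (t.cost + k) τ
  | loopFalse {t : BExp} {c : Prog} {σ : State} (ht : ¬ t.holds σ) :
      Exec (.loop t c) σ t.cost σ
  | loopTrue {t : BExp} {c : Prog} {σ τ υ : State} {k m : ℕ} (ht : t.holds σ) (h₁ : Exec c σ k τ)
      (h₂ : Exec (.loop t c) τ m υ) : Exec (.loop t c) σ (t.cost + k + m) υ

/-- The state `σ` holds the input `(p i, ℓ i)`, `i < n`: register `0` holds `n`, and five consecutive
cells for every `i` hold the coordinates of `p i` and the coefficients of some equation
`α x + β y = γ` of the line `ℓ i`. Everything else in `σ` is arbitrary. -/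
def HoldsInput {n : ℕ} (σ : State) (p : Fin n → Plane) (ℓ : Fin n → AffineSubspace ℝ Plane) :
    Prop :=
  σ.nat 0 = n ∧ ∀ i : Fin n,
    σ.mem (5 * (i : ℕ)) = p i 0 ∧ σ.mem (5 * (i : ℕ) + 1) = p i 1 ∧
    (ℓ i : Set Plane) = {q | σ.mem (5 * (i : ℕ) + 2) * q 0 + σ.mem (5 * (i : ℕ) + 3) * q 1 =
      σ.mem (5 * (i : ℕ) + 4)}

/-- The state `σ` holds the set `C` as a list: register `0` holds the length of the list, register
`1` its address, and six consecutive cells hold the entries of `R` (by rows) and of `t` for every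
`(R, t)` of the list. -/
def HoldsOutput (σ : State) (C : Set Alignment) : Prop :=
  ∃ a : Fin (σ.nat 0) → Alignment, C = Set.range a ∧ ∀ i : Fin (σ.nat 0),
    σ.mem (σ.nat 1 + 6 * (i : ℕ)) = (a i).1.1 0 0 ∧
    σ.mem (σ.nat 1 + 6 * (i : ℕ) + 1) = (a i).1.1 0 1 ∧
    σ.mem (σ.nat 1 + 6 * (i : ℕ) + 2) = (a i).1.1 1 0 ∧
    σ.mem (σ.nat 1 + 6 * (i : ℕ) + 3) = (a i).1.1 1 1 ∧
    σ.mem (σ.nat 1 + 6 * (i : ℕ) + 4) = (a i).2 0 ∧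
    σ.mem (σ.nat 1 + 6 * (i : ℕ) + 5) = (a i).2 1

end PointsToLines

end

/-!
Identify the plane with `ℂ`. An alignment becomes `z ↦ ρ z - t` with `|ρ| = 1`, and the distance of
the image of `p i` to `ℓ i` is, up to a factor, the absolute value of a residual that is real affine
in `(ρ, t)`.

Given an alignment, translate it until the smallest residual, that of `j` say, vanishes; by
minimality no residual more than doubles. Then translate along `ℓ j` until the residual of some `k`
vanishes that needs the shortest translation; again no residual more than doubles. As long as these
two residuals stay zero, `t` is a function of `ρ`, and every residual becomes an affine form
`⟪w, ρ⟫ - g` on the unit circle. Its absolute value is, up to an additive constant that is its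
minimum, `‖w‖ / 2` times the product of the distances of `ρ` to the minimizers, which are two points
`u e` and `u e⁻¹` that may coincide. Now rotate `ρ` to the closest of the minimizers of all these
forms: the distance to any minimizer at most doubles, so the residuals grow at most by the factor
`4`, and in total by `2 * 2 * 4 = 16`. If all lines are parallel, the second translation is omitted.

The minimizers are computed with square roots only, since the coordinates of `e` are the cosine and
the sine of an `arccos`. The program therefore lists at most two alignments for each of the at most
`n ^ 3` triples.
-/

open scoped Matrix

noncomputable section

namespace PointsToLines

open Complex (I)
open scoped ComplexConjugate RealInnerProductSpace

/-! ### The complex plane -/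

/-- The identification `(x, y) ↦ x + y i` of the Euclidean plane with `ℂ`. -/
def toComplex : Plane ≃ₗᵢ[ℝ] ℂ := Complex.orthonormalBasisOneI.repr.symm

@[simp]
theorem toComplex_re (x : Plane) : (toComplex x).re = x 0 := by
  simp [toComplex]

@[simp]
theorem toComplex_im (x : Plane) : (toComplex x).im = x 1 := by
  simp [toComplex]

theorem inner_eq_re_add_im (z w : ℂ) : ⟪z, w⟫ = z.re * w.re + z.im * w.im := by
  rw [Complex.inner, Complex.mul_re, Complex.conj_re, Complex.conj_im]
  ring

theorem inner_mul_self_of_re_eq_zero {c : ℂ} (hc : c.re = 0) (z : ℂ) : ⟪z, c * z⟫ = 0 := by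
  rw [inner_eq_re_add_im, Complex.mul_re, Complex.mul_im, hc]
  ring

theorem act_apply (M : Matrix (Fin 2) (Fin 2) ℝ) (x : Plane) (i : Fin 2) :
    act M x i = M i 0 * x 0 + M i 1 * x 1 :=
  Fin.sum_univ_two fun j => M i j * x j

theorem toComplex_act_conformal (z : ℂ) (x : Plane) :
    toComplex (act !![z.re, -z.im; z.im, z.re] x) = z * toComplex x := by
  apply Complex.ext
  · simp [act_apply, sub_eq_add_neg]
  · simp [act_apply, add_comm]

/-- Rotation matrices as complex numbers of modulus `1`. -/
def rotationEquiv : Matrix.specialOrthogonalGroup (Fin 2) ℝ ≃ Circle where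
  toFun R := ⟨⟨R.1 0 0, R.1 1 0⟩, mem_sphere_zero_iff_norm.2 <| by
    obtain ⟨-, h₀₁, h⟩ := Matrix.mem_specialOrthogonalGroup_fin_two_iff.1 R.2
    rw [h₀₁, neg_sq] at h
    rw [Complex.norm_eq_sqrt_sq_add_sq, h, Real.sqrt_one]⟩
  invFun ρ := ⟨!![(ρ : ℂ).re, -(ρ : ℂ).im; (ρ : ℂ).im, (ρ : ℂ).re],
    Matrix.of_mem_specialOrthogonalGroup_fin_two_iff.2 ⟨rfl, rfl, by
      rw [neg_sq, sq, sq, ← Complex.normSq_apply, Circle.normSq_coe]⟩⟩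
  left_inv R := by
    obtain ⟨h₀₀, h₀₁, -⟩ := Matrix.mem_specialOrthogonalGroup_fin_two_iff.1 R.2
    refine Subtype.ext (Matrix.ext fun i j => ?_)
    fin_cases i <;> fin_cases j
    exacts [rfl, h₀₁.symm, rfl, h₀₀]
  right_inv _ := rfl

namespace Alignment

/-- The rotation of an alignment, as a complex number of modulus `1`. -/
def rot (a : Alignment) : Circle := rotationEquiv a.1

/-- The alignment `z ↦ ρ z - t` of the complex plane. -/
def ofComplex (ρ : Circle) (t : ℂ) : Alignment := (rotationEquiv.symm ρ, toComplex.symm t)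

@[simp]
theorem rot_ofComplex (ρ : Circle) (t : ℂ) : (ofComplex ρ t).rot = ρ :=
  rotationEquiv.apply_symm_apply ρ

@[simp]
theorem toComplex_snd_ofComplex (ρ : Circle) (t : ℂ) : toComplex (ofComplex ρ t).2 = t :=
  toComplex.apply_symm_apply t

theorem fst_eq_iff {a a' : Alignment} : a.1 = a'.1 ↔ a.rot = a'.rot :=
  rotationEquiv.injective.eq_iff.symm

theorem ext_rot {a a' : Alignment} (hrot : a.rot = a'.rot) (h : toComplex a.2 = toComplex a'.2) :
    a = a' :=
  Prod.ext (fst_eq_iff.2 hrot) (toComplex.injective h)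

theorem coe_fst (a : Alignment) :
    (a.1 : Matrix (Fin 2) (Fin 2) ℝ) =
      !![(a.rot : ℂ).re, -(a.rot : ℂ).im; (a.rot : ℂ).im, (a.rot : ℂ).re] :=
  congrArg Subtype.val (rotationEquiv.symm_apply_apply a.1).symm

theorem toComplex_app (a : Alignment) (p : Plane) :
    toComplex (a.app p) = a.rot * toComplex p - toComplex a.2 := by
  rw [app, map_sub, coe_fst, toComplex_act_conformal]

end Alignment

/-! ### Points and lines -/

theorem infDist_hyperplane {E : Type*} [NormedAddCommGroup E] [InnerProductSpace ℝ E] {ν : E}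
    (hν : ν ≠ 0) (γ : ℝ) (q : E) :
    Metric.infDist q {z | ⟪ν, z⟫ = γ} = |⟪ν, q⟫ - γ| / ‖ν‖ := by
  have hν₀ : 0 < ‖ν‖ := norm_pos_iff.2 hν
  set foot : E := q - ((⟪ν, q⟫ - γ) / ‖ν‖ ^ 2) • ν
  have foot_mem : foot ∈ {z | ⟪ν, z⟫ = γ} := by
    rw [Set.mem_ofPred_eq, inner_sub_right, real_inner_smul_right, real_inner_self_eq_norm_sq,
      div_mul_cancel₀ _ (pow_ne_zero 2 hν₀.ne'), sub_sub_cancel]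
  apply le_antisymm
  · refine (Metric.infDist_le_dist_of_mem foot_mem).trans_eq ?_
    rw [dist_eq_norm, sub_sub_cancel, norm_smul, Real.norm_eq_abs, abs_div,
      abs_of_pos (pow_pos hν₀ 2)]
    field_simp
  · refine (Metric.le_infDist ⟨foot, foot_mem⟩).2 fun z hz => ?_
    rw [div_le_iff₀' hν₀, dist_eq_norm, ← (show ⟪ν, z⟫ = γ from hz), ← inner_sub_right]
    exact abs_real_inner_le_norm ν (q - z)

/-- A point and an equation `⟪normal, z⟫ = offset` of a line in the complex plane. -/
structure Datum where
  point : ℂ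
  normal : ℂ
  offset : ℝ

namespace Datum

variable (d d₁ d₂ : Datum)

/-- The residual of the equation of the line at the image of the point under an alignment. -/
def res (a : Alignment) : ℝ := ⟪d.normal, a.rot * d.point - toComplex a.2⟫ - d.offset

/-- `d` gives the point `p` and an equation of the line `ℓ`. -/
structure Describes (p : Plane) (ℓ : AffineSubspace ℝ Plane) : Prop where
  point_eq : d.point = toComplex p
  normal_ne_zero : d.normal ≠ 0
  mem_line_iff : ∀ q, q ∈ ℓ ↔ ⟪d.normal, toComplex q⟫ = d.offset

/-- The determinant of the two normals; it vanishes exactly for parallel lines. -/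
def det : ℝ := (conj d₁.normal * d₂.normal).im

variable {d} {p : Plane} {ℓ : AffineSubspace ℝ Plane}

namespace Describes

theorem res_eq (h : d.Describes p ℓ) (a : Alignment) :
    d.res a = ⟪d.normal, toComplex (a.app p)⟫ - d.offset := by
  rw [res, h.point_eq, Alignment.toComplex_app]

theorem app_mem_iff (h : d.Describes p ℓ) (a : Alignment) : a.app p ∈ ℓ ↔ d.res a = 0 := by
  rw [h.mem_line_iff, h.res_eq, sub_eq_zero]

theorem lineDist_app (h : d.Describes p ℓ) (a : Alignment) :
    lineDist (a.app p) ℓ = |d.res a| / ‖d.normal‖ := by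
  have hℓ : (ℓ : Set Plane) = {q | inner ℝ (toComplex.symm d.normal) q = d.offset} := by
    ext q
    rw [SetLike.mem_coe, h.mem_line_iff, Set.mem_ofPred_eq, toComplex.symm.inner_map_eq_flip]
    rfl
  have hν : toComplex.symm d.normal ≠ 0 :=
    (map_ne_zero_iff _ toComplex.symm.injective).2 h.normal_ne_zero
  rw [lineDist, hℓ, infDist_hyperplane hν, LinearIsometryEquiv.norm_map, h.res_eq,
    toComplex.symm.inner_map_eq_flip]
  rfl

theorem lineDist_app_le_iff (h : d.Describes p ℓ) (a a' : Alignment) :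
    lineDist (a.app p) ℓ ≤ lineDist (a'.app p) ℓ ↔ |d.res a| ≤ |d.res a'| := by
  rw [h.lineDist_app, h.lineDist_app, div_le_div_iff_of_pos_right (norm_pos_iff.2 h.normal_ne_zero)]

end Describes

end Datum

/-! ### Affine forms on the unit circle -/

/-- The pair `(w, g)` stands for the affine form `z ↦ ⟪w, z⟫ - g` on the complex plane, so that
linear combinations of forms are those of pairs. -/
abbrev AffineForm : Type := ℂ × ℝ

namespace AffineForm

/-- The value of an affine form. -/
def eval (f : AffineForm) (z : ℂ) : ℝ := ⟪f.1, z⟫ - f.2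

/-- The points of the unit circle at which the absolute value of an affine form is minimal. -/
def circleMin (f : AffineForm) : Set Circle := {ρ | ∀ ρ' : Circle, |f.eval ρ| ≤ |f.eval ρ'|}

/-- For `f = (w, g)` with `w ≠ 0`, the points of the unit circle at the angles `± arccos (g / ‖w‖)`
from `w`; here `ε` is the sign. Since `arccos` truncates its argument to `[-1, 1]`, both are
`± w / ‖w‖` if `|g| ≥ ‖w‖`. -/
def circleMinimizer (f : AffineForm) (ε : ℤ) : Circle :=
  Circle.exp (f.1.arg + ε * Real.arccos (f.2 / ‖f.1‖))

/-- A list of the points of `circleMin` if these are finitely many, of one of them otherwise. -/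
def circleMinimizers (f : AffineForm) : List Circle :=
  open Classical in
  if f.1 = 0 then [1] else [f.circleMinimizer 1, f.circleMinimizer (-1)]

theorem dist_mul_dist (ρ u e : Circle) :
    dist ρ (u * e) * dist ρ (u * e⁻¹) = 2 * |⟪(u : ℂ), ρ⟫ - (e : ℂ).re| := by
  have add_inv (z : Circle) : (z : ℂ) + (z⁻¹ : Circle) = (2 * (z : ℂ).re : ℝ) := by
    rw [Circle.coe_inv_eq_conj, Complex.add_conj]
  have hinner : ⟪(u : ℂ), ρ⟫ = ((ρ * u⁻¹ : Circle) : ℂ).re := by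
    rw [Complex.inner, Circle.coe_mul, Circle.coe_inv_eq_conj]
  have dist_eq (x y : Circle) : dist x y = ‖(x : ℂ) - y‖ := dist_eq_norm (x : ℂ) y
  have factorization : ((ρ : ℂ) - (u * e : Circle)) * (ρ - (u * e⁻¹ : Circle)) =
      ρ * u * ((2 * (⟪(u : ℂ), ρ⟫ - (e : ℂ).re) : ℝ) : ℂ) := by
    rw [hinner, mul_sub 2, Complex.ofReal_sub, ← add_inv, ← add_inv]
    have hρ := Circle.coe_ne_zero ρ
    have hu := Circle.coe_ne_zero u
    have he := Circle.coe_ne_zero e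
    push_cast
    field_simp
    ring
  rw [dist_eq, dist_eq, ← norm_mul, factorization, norm_mul, norm_mul, Circle.norm_coe,
    Circle.norm_coe, Complex.norm_real, Real.norm_eq_abs, abs_mul, abs_two, one_mul, one_mul]

theorem abs_sub_eq_add_cos_arccos {x y : ℝ} (hy : |y| ≤ 1) :
    |y - x| = |y - Real.cos (Real.arccos x)| + |Real.cos (Real.arccos x) - x| := by
  obtain ⟨hy₁, hy₂⟩ := abs_le.1 hy
  rcases le_or_gt x (-1) with hx | hx
  · rw [Real.arccos_of_le_neg_one hx, Real.cos_pi, abs_of_nonneg (by linarith),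
      abs_of_nonneg (by linarith), abs_of_nonneg (by linarith)]
    ring
  rcases le_or_gt x 1 with hx' | hx'
  · rw [Real.cos_arccos hx.le hx', sub_self, abs_zero, add_zero]
  · rw [Real.arccos_of_one_le hx'.le, Real.cos_zero, abs_of_nonpos (by linarith),
      abs_of_nonpos (by linarith), abs_of_nonpos (by linarith)]
    ring

variable (f : AffineForm)

theorem abs_eval_eq (ρ : Circle) :
    |f.eval ρ| = ‖f.1‖ / 2 * (dist ρ (f.circleMinimizer 1) * dist ρ (f.circleMinimizer (-1))) +
      |‖f.1‖ * Real.cos (Real.arccos (f.2 / ‖f.1‖)) - f.2| := by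
  rcases eq_or_ne f.1 0 with hf | hf
  · simp [eval, hf]
  have hnorm : 0 < ‖f.1‖ := norm_pos_iff.2 hf
  set u := Circle.exp f.1.arg
  have hw : f.1 = ‖f.1‖ • (u : ℂ) := by
    rw [Circle.coe_exp, Complex.real_smul, Complex.norm_mul_exp_arg_mul_I]
  have hfactor := dist_mul_dist ρ u (Circle.exp (Real.arccos (f.2 / ‖f.1‖)))
  rw [← Circle.exp_neg, ← Circle.exp_add, ← Circle.exp_add,
    Circle.coe_exp (Real.arccos _), Complex.exp_ofReal_mul_I_re] at hfactor
  have hle : |⟪(u : ℂ), ρ⟫| ≤ 1 := by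
    simpa only [Circle.norm_coe, one_mul] using abs_real_inner_le_norm (u : ℂ) ρ
  have habs (x : ℝ) : |‖f.1‖ * x - f.2| = ‖f.1‖ * |x - f.2 / ‖f.1‖| := by
    rw [← abs_of_pos hnorm, ← abs_mul, abs_of_pos hnorm, mul_sub, mul_div_cancel₀ _ hnorm.ne']
  have heval : f.eval ρ = ‖f.1‖ * ⟪(u : ℂ), ρ⟫ - f.2 := by
    rw [eval, ← real_inner_smul_left, ← hw]
  rw [heval, habs, habs, abs_sub_eq_add_cos_arccos hle, circleMinimizer, circleMinimizer,
    Int.cast_one, one_mul, Int.cast_neg, Int.cast_one, neg_one_mul, hfactor]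
  ring

variable {f}

theorem circleMin_eq (hf : f.1 ≠ 0) :
    f.circleMin = {f.circleMinimizer 1, f.circleMinimizer (-1)} := by
  have hnorm : 0 < ‖f.1‖ := norm_pos_iff.2 hf
  ext ρ
  rw [Set.mem_insert_iff, Set.mem_singleton_iff]
  constructor
  · intro hρ
    have hle := hρ (f.circleMinimizer 1)
    rw [abs_eval_eq, abs_eval_eq, dist_self, zero_mul, mul_zero, add_le_add_iff_right] at hle
    have hprod := le_antisymm (nonpos_of_mul_nonpos_right hle (half_pos hnorm)) (by positivity)
    rwa [mul_eq_zero, dist_eq_zero, dist_eq_zero] at hprod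
  · intro hρ ρ'
    have hprod : dist ρ (f.circleMinimizer 1) * dist ρ (f.circleMinimizer (-1)) = 0 := by
      rcases hρ with rfl | rfl <;> simp only [dist_self, zero_mul, mul_zero]
    rw [abs_eval_eq, abs_eval_eq, hprod, mul_zero]
    gcongr
    positivity

theorem circleMin_eq_univ (hf : f.1 = 0) : f.circleMin = Set.univ :=
  Set.eq_univ_of_forall fun ρ ρ' => by rw [eval, eval, hf, inner_zero_left, inner_zero_left]

theorem infinite_circle : Infinite Circle :=
  have : Nontrivial Circle := ⟨1, -1, fun h => by norm_num [Circle.ext_iff, Complex.ext_iff] at h⟩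
  PreconnectedSpace.infinite

theorem circleMin_finite_iff : f.circleMin.Finite ↔ f.1 ≠ 0 := by
  refine ⟨fun hfin hf => ?_, fun hf => ?_⟩
  · have := infinite_circle
    exact Set.infinite_univ (circleMin_eq_univ hf ▸ hfin)
  · rw [circleMin_eq hf]
    exact Set.toFinite _

theorem mem_circleMinimizers (hf : f.1 ≠ 0) {ρ : Circle} :
    ρ ∈ f.circleMinimizers ↔ ρ ∈ f.circleMin := by
  simp only [circleMinimizers, if_neg hf, circleMin_eq hf, List.mem_cons, List.not_mem_nil,
    or_false, Set.mem_insert_iff, Set.mem_singleton_iff]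

theorem circleMinimizers_of_eq_zero (hf : f.1 = 0) : f.circleMinimizers = [1] := if_pos hf

variable (f) in
theorem circleMin_nonempty : f.circleMin.Nonempty := by
  rcases eq_or_ne f.1 0 with hf | hf
  · exact circleMin_eq_univ hf ▸ Set.univ_nonempty
  · exact circleMin_eq hf ▸ Set.insert_nonempty _ _

theorem abs_eval_le_four_mul {ρ₀ ρ : Circle}
    (h : f.1 ≠ 0 → ∀ ρ' ∈ f.circleMin, dist ρ ρ₀ ≤ dist ρ' ρ₀) :
    |f.eval ρ| ≤ 4 * |f.eval ρ₀| := by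
  rcases eq_or_ne f.1 0 with hf | hf
  · rw [eval, eval, hf, inner_zero_left, inner_zero_left]
    linarith [abs_nonneg (0 - f.2)]
  have dist_le (ε : ℤ) (hε : f.circleMinimizer ε ∈ f.circleMin) :
      dist ρ (f.circleMinimizer ε) ≤ 2 * dist ρ₀ (f.circleMinimizer ε) := by
    linarith [h hf _ hε, dist_triangle ρ ρ₀ (f.circleMinimizer ε),
      dist_comm ρ₀ (f.circleMinimizer ε)]
  have h₁ := dist_le 1 (circleMin_eq hf ▸ Set.mem_insert _ _)
  have h₂ := dist_le (-1) (circleMin_eq hf ▸ Set.mem_insert_of_mem _ rfl)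
  have hprod := mul_le_mul_of_nonneg_left (mul_le_mul h₁ h₂ dist_nonneg (by positivity))
    (by positivity : 0 ≤ ‖f.1‖ / 2)
  rw [abs_eval_eq, abs_eval_eq f ρ₀]
  linarith [abs_nonneg (‖f.1‖ * Real.cos (Real.arccos (f.2 / ‖f.1‖)) - f.2)]

theorem exists_forall_abs_eval_le {ι : Type*} [Finite ι] [Nonempty ι] (f : ι → AffineForm)
    (ρ₀ : Circle) : ∃ i, ∀ T : Set Circle, T.Nonempty → ((f i).1 ≠ 0 → (f i).circleMin ⊆ T) →
      ∃ ρ ∈ T, ∀ k, |(f k).eval ρ| ≤ 4 * |(f k).eval ρ₀| := by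
  set candidates : Set Circle := ⋃ i ∈ {i | (f i).1 ≠ 0}, (f i).circleMin
  have hfinite : candidates.Finite :=
    (Set.toFinite _).biUnion fun i hi => circleMin_finite_iff.2 hi
  rcases candidates.eq_empty_or_nonempty with hempty | hne
  · refine ⟨Classical.arbitrary ι, fun T ⟨ρ, hρ⟩ _ => ⟨ρ, hρ, fun k => ?_⟩⟩
    refine abs_eval_le_four_mul fun hk ρ' hρ' => False.elim ?_
    exact (hempty ▸ Set.mem_biUnion hk hρ' : ρ' ∈ (∅ : Set Circle))
  · obtain ⟨ρ, hρ, hnearest⟩ := candidates.exists_min_image (dist · ρ₀) hfinite hne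
    obtain ⟨i, hi, hρi⟩ := Set.mem_iUnion₂.1 hρ
    exact ⟨i, fun T _ hT => ⟨ρ, hT hi hρi, fun k =>
      abs_eval_le_four_mul fun hk ρ' hρ' => hnearest ρ' (Set.mem_biUnion hk hρ')⟩⟩

theorem eval_sub (f g : AffineForm) (z : ℂ) : (f - g).eval z = f.eval z - g.eval z := by
  rw [eval, eval, eval, Prod.fst_sub, Prod.snd_sub, inner_sub_left]
  ring

theorem eval_smul (c : ℝ) (f : AffineForm) (z : ℂ) : (c • f).eval z = c * f.eval z := by
  rw [eval, eval, Prod.smul_fst, Prod.smul_snd, real_inner_smul_left, smul_eq_mul]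
  ring

end AffineForm

/-! ### Alignments with one or two of the points on their lines -/

namespace Datum

/-- The residual, as a function of the rotation, for the translation `0`. -/
def form (d : Datum) : AffineForm := (d.normal * conj d.point, d.offset)

theorem res_eq_form_eval (d : Datum) (a : Alignment) :
    d.res a = d.form.eval a.rot - ⟪d.normal, toComplex a.2⟫ := by
  have hadjoint : ⟪d.normal, a.rot * d.point⟫ = ⟪d.normal * conj d.point, (a.rot : ℂ)⟫ := by
    rw [Complex.inner, Complex.inner, map_mul, Complex.conj_conj]
    ring_nf
  rw [res, AffineForm.eval, form, inner_sub_right, hadjoint]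
  ring

theorem det_eq_inner_I_mul (d₁ d₂ : Datum) : d₁.det d₂ = ⟪I * d₁.normal, d₂.normal⟫ := by
  rw [inner_eq_re_add_im, det, Complex.I_mul_re, Complex.I_mul_im, Complex.mul_im,
    Complex.conj_re, Complex.conj_im]
  ring

theorem normal_eq_smul {d₁ d₂ : Datum} (h₁ : d₁.normal ≠ 0) (hdet : d₁.det d₂ = 0) :
    d₂.normal = (⟪d₂.normal, d₁.normal⟫ / ‖d₁.normal‖ ^ 2) • d₁.normal := by
  have hnorm : ‖d₁.normal‖ ^ 2 ≠ 0 := pow_ne_zero 2 (norm_ne_zero_iff.2 h₁)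
  rw [div_eq_inv_mul, mul_smul, eq_inv_smul_iff₀ hnorm, ← Complex.normSq_eq_norm_sq,
    Complex.normSq_apply, inner_eq_re_add_im]
  rw [det, Complex.mul_im, Complex.conj_re, Complex.conj_im] at hdet
  apply Complex.ext <;> simp only [Complex.smul_re, Complex.smul_im, smul_eq_mul]
  · linear_combination (-d₁.normal.im) * hdet
  · linear_combination d₁.normal.re * hdet

theorem eq_of_inner_eq {d₁ d₂ : Datum} (hdet : d₁.det d₂ ≠ 0) {z w : ℂ}
    (h₁ : ⟪d₁.normal, z⟫ = ⟪d₁.normal, w⟫) (h₂ : ⟪d₂.normal, z⟫ = ⟪d₂.normal, w⟫) : z = w := by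
  simp only [det, Complex.mul_im, Complex.conj_re, Complex.conj_im] at hdet
  rw [inner_eq_re_add_im, inner_eq_re_add_im] at h₁ h₂
  refine Complex.ext (mul_left_cancel₀ hdet ?_) (mul_left_cancel₀ hdet ?_)
  · linear_combination d₂.normal.im * h₁ - d₁.normal.im * h₂
  · linear_combination d₁.normal.re * h₂ - d₂.normal.re * h₁

end Datum

/-- Two vectors whose combinations, weighted by the values of the forms of two data, serve as
translations. -/
structure Frame where
  fst : ℂ
  snd : ℂ

namespace Frame

/-- The alignment with a given rotation whose translation is the combination given by the frame. -/
def align (F : Frame) (d₁ d₂ : Datum) (ρ : Circle) : Alignment :=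
  .ofComplex ρ (d₁.form.eval ρ • F.fst + d₂.form.eval ρ • F.snd)

/-- The residual of `d₃` at the alignments `F.align d₁ d₂ ρ`, as a function of `ρ`. -/
def form (F : Frame) (d₁ d₂ d₃ : Datum) : AffineForm :=
  d₃.form - ⟪d₃.normal, F.fst⟫ • d₁.form - ⟪d₃.normal, F.snd⟫ • d₂.form

/-- The basis dual to the normals of `d₁` and `d₂`. -/
def cross (d₁ d₂ : Datum) : Frame where
  fst := (d₁.det d₂)⁻¹ • (-I * d₂.normal)
  snd := (d₁.det d₂)⁻¹ • (I * d₁.normal)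

/-- The frame for translations along the normal of `d`. -/
def slide (d : Datum) : Frame where
  fst := (‖d.normal‖ ^ 2)⁻¹ • d.normal
  snd := 0

@[simp]
theorem rot_align (F : Frame) (d₁ d₂ : Datum) (ρ : Circle) : (F.align d₁ d₂ ρ).rot = ρ :=
  Alignment.rot_ofComplex _ _

theorem res_align (F : Frame) (d₁ d₂ d₃ : Datum) (ρ : Circle) :
    d₃.res (F.align d₁ d₂ ρ) = (F.form d₁ d₂ d₃).eval ρ := by
  rw [Datum.res_eq_form_eval, rot_align, align, Alignment.toComplex_snd_ofComplex, inner_add_right,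
    real_inner_smul_right, real_inner_smul_right, form, AffineForm.eval_sub, AffineForm.eval_sub,
    AffineForm.eval_smul, AffineForm.eval_smul]
  ring

section Cross

variable {d₁ d₂ : Datum} (hdet : d₁.det d₂ ≠ 0)
include hdet

theorem inner_cross :
    ⟪d₁.normal, (cross d₁ d₂).fst⟫ = 1 ∧ ⟪d₂.normal, (cross d₁ d₂).fst⟫ = 0 ∧
      ⟪d₁.normal, (cross d₁ d₂).snd⟫ = 0 ∧ ⟪d₂.normal, (cross d₁ d₂).snd⟫ = 1 := by
  simp only [cross, real_inner_smul_right]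
  have h₁₁ : ⟪d₁.normal, -I * d₂.normal⟫ = d₁.det d₂ := by
    rw [inner_eq_re_add_im, Datum.det, neg_mul, Complex.neg_re, Complex.neg_im, Complex.I_mul_re,
      Complex.I_mul_im, Complex.mul_im, Complex.conj_re, Complex.conj_im]
    ring
  have h₂₂ : ⟪d₂.normal, I * d₁.normal⟫ = d₁.det d₂ := by
    rw [Datum.det_eq_inner_I_mul, real_inner_comm]
  rw [h₁₁, h₂₂, inner_mul_self_of_re_eq_zero (by simp), inner_mul_self_of_re_eq_zero (by simp),
    inv_mul_cancel₀ hdet]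
  norm_num

theorem exists_inner_eq (x y : ℝ) : ∃ z, ⟪d₁.normal, z⟫ = x ∧ ⟪d₂.normal, z⟫ = y := by
  obtain ⟨h₁₁, h₂₁, h₁₂, h₂₂⟩ := inner_cross hdet
  refine ⟨x • (cross d₁ d₂).fst + y • (cross d₁ d₂).snd, ?_, ?_⟩
  · rw [inner_add_right, real_inner_smul_right, real_inner_smul_right, h₁₁, h₁₂]
    ring
  · rw [inner_add_right, real_inner_smul_right, real_inner_smul_right, h₂₁, h₂₂]
    ring

theorem align_cross_of_res_eq_zero {a : Alignment} (h₁ : d₁.res a = 0) (h₂ : d₂.res a = 0) :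
    a = (cross d₁ d₂).align d₁ d₂ a.rot := by
  refine Alignment.ext_rot (rot_align _ _ _ _).symm ?_
  obtain ⟨h₁₁, h₂₁, h₁₂, h₂₂⟩ := inner_cross hdet
  rw [Datum.res_eq_form_eval, sub_eq_zero] at h₁ h₂
  rw [align, Alignment.toComplex_snd_ofComplex]
  apply Datum.eq_of_inner_eq hdet <;>
    rw [inner_add_right, real_inner_smul_right, real_inner_smul_right]
  · rw [h₁₁, h₁₂, h₁]
    ring
  · rw [h₂₁, h₂₂, h₂]
    ring

theorem form_cross_eq_zero :
    (cross d₁ d₂).form d₁ d₂ d₁ = 0 ∧ (cross d₁ d₂).form d₁ d₂ d₂ = 0 := by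
  obtain ⟨h₁₁, h₂₁, h₁₂, h₂₂⟩ := inner_cross hdet
  rw [form, form, h₁₁, h₂₁, h₁₂, h₂₂]
  simp only [one_smul, zero_smul, sub_self, sub_zero, and_self]

end Cross

section Slide

variable {d₁ d₂ : Datum} (h₁ : d₁.normal ≠ 0)
include h₁

theorem inner_slide : ⟪d₁.normal, (slide d₁).fst⟫ = 1 := by
  rw [slide, real_inner_smul_right, real_inner_self_eq_norm_sq]
  exact inv_mul_cancel₀ (pow_ne_zero 2 (norm_ne_zero_iff.2 h₁))

theorem form_slide_eq_zero : (slide d₁).form d₁ d₂ d₁ = 0 := by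
  rw [form, inner_slide h₁, slide, inner_zero_right, one_smul, zero_smul, sub_self, sub_zero]

theorem res_eq_form_slide_eval (hdet : d₁.det d₂ = 0) {a : Alignment} (ha : d₁.res a = 0) :
    d₂.res a = ((slide d₁).form d₁ d₂ d₂).eval a.rot := by
  rw [Datum.res_eq_form_eval, sub_eq_zero] at ha
  have hinner : ⟪d₂.normal, (slide d₁).fst⟫ = ⟪d₂.normal, d₁.normal⟫ / ‖d₁.normal‖ ^ 2 := by
    rw [slide, real_inner_smul_right, inv_mul_eq_div]
  rw [Datum.res_eq_form_eval, form, AffineForm.eval_sub, AffineForm.eval_sub, AffineForm.eval_smul,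
    AffineForm.eval_smul, hinner, ha, ← real_inner_smul_left, ← Datum.normal_eq_smul h₁ hdet]
  rw [slide, inner_zero_right, zero_mul, sub_zero]

end Slide

end Frame

/-! ### Selections -/

theorem forall_existsUnique_mem_iff_bijOn_fst {X Y : Type*} {F S : Set (X × Y)} (hS : S ⊆ F) :
    (∀ x ∈ Prod.fst '' F, ∃! y, (x, y) ∈ S) ↔ Set.BijOn Prod.fst S (Prod.fst '' F) := by
  constructor
  · intro h
    refine ⟨fun a ha => ⟨a, hS ha, rfl⟩, fun a ha a' ha' heq => ?_, fun x hx => ?_⟩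
    · exact Prod.ext heq ((h a.1 ⟨a, hS ha, rfl⟩).unique ha (heq ▸ ha'))
    · obtain ⟨y, hy, -⟩ := h x hx
      exact ⟨(x, y), hy, rfl⟩
  · rintro ⟨-, hinj, hsurj⟩ x hx
    obtain ⟨⟨x, y⟩, hxy, rfl⟩ := hsurj hx
    exact ⟨y, hxy, fun y' hy' => (Prod.mk.inj (hinj hy' hxy rfl)).2⟩

theorem isSelectionPerRotation_iff {F S : Set Alignment} :
    IsSelectionPerRotation F S ↔
      ((Prod.fst '' F).Finite ∧ S ⊆ F ∧ Set.BijOn Prod.fst S (Prod.fst '' F)) ∨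
        ((Prod.fst '' F).Infinite ∧ ∃ a ∈ F, S = {a}) :=
  or_congr_left (and_congr_right fun _ => and_congr_right forall_existsUnique_mem_iff_bijOn_fst)

theorem isSelection_iff_isSelectionPerRotation {F S : Set Alignment} (hF : F.InjOn Prod.fst) :
    IsSelection F S ↔ IsSelectionPerRotation F S := by
  rw [IsSelection, isSelectionPerRotation_iff, Set.finite_image_iff hF, Set.infinite_image_iff hF]
  refine or_congr_left (and_congr_right fun _ => ⟨?_, fun ⟨hS, hbij⟩ => ?_⟩)
  · rintro rfl
    exact ⟨subset_rfl, hF.bijOn_image⟩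
  · refine hS.antisymm fun a ha => ?_
    obtain ⟨a', ha', heq⟩ := hbij.surjOn ⟨a, ha, rfl⟩
    exact hF (hS ha') ha heq ▸ ha'

theorem IsSelectionPerRotation.subset {F S : Set Alignment} (h : IsSelectionPerRotation F S) :
    S ⊆ F := by
  rcases h with ⟨-, hS, -⟩ | ⟨-, a, ha, rfl⟩
  exacts [hS, Set.singleton_subset_iff.2 ha]

theorem IsSelectionPerRotation.nonempty {F S : Set Alignment} (h : IsSelectionPerRotation F S)
    (hF : F.Nonempty) : S.Nonempty := by
  rcases isSelectionPerRotation_iff.1 h with ⟨-, -, hbij⟩ | ⟨-, a, -, rfl⟩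
  · obtain ⟨a, ha, -⟩ := hbij.surjOn (hF.image Prod.fst).some_mem
    exact ⟨a, ha⟩
  · exact Set.singleton_nonempty a

/-! ### Alignments that minimize a residual -/

/-- The alignments of `A` that bring the point of `d` as close to its line as possible. -/
def minimizers (A : Set Alignment) (d : Datum) : Set Alignment :=
  {a ∈ A | ∀ a' ∈ A, |d.res a| ≤ |d.res a'|}

/-- On `A`, the residual of `d` is the affine form `f` of the rotation, and `s` gives an element of
`A` for every rotation. -/
structure Reduces (A : Set Alignment) (d : Datum) (f : AffineForm) (s : Circle → Alignment) :
    Prop where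
  rot_section : ∀ ρ, (s ρ).rot = ρ
  section_mem : ∀ ρ, s ρ ∈ A
  res_eq : ∀ a ∈ A, d.res a = f.eval a.rot

theorem Frame.reduces_cross {d₁ d₂ : Datum} (hdet : d₁.det d₂ ≠ 0) (d₃ : Datum) :
    Reduces {a | d₁.res a = 0 ∧ d₂.res a = 0} d₃ ((cross d₁ d₂).form d₁ d₂ d₃)
      ((cross d₁ d₂).align d₁ d₂) where
  rot_section := rot_align _ _ _
  section_mem ρ := by
    obtain ⟨h₁, h₂⟩ := form_cross_eq_zero hdet
    rw [Set.mem_ofPred_eq, res_align, res_align, h₁, h₂, AffineForm.eval]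
    simp
  res_eq a ha := by
    rw [← res_align, ← align_cross_of_res_eq_zero hdet ha.1 ha.2]

theorem Frame.reduces_slide {d₁ d₂ : Datum} (h₁ : d₁.normal ≠ 0) (hdet : d₁.det d₂ = 0) :
    Reduces {a | d₁.res a = 0} d₂ ((slide d₁).form d₁ d₂ d₂) ((slide d₁).align d₁ d₂) where
  rot_section := rot_align _ _ _
  section_mem ρ := by
    rw [Set.mem_ofPred_eq, res_align, form_slide_eq_zero h₁, AffineForm.eval]
    simp
  res_eq _ ha := res_eq_form_slide_eval h₁ hdet ha

namespace Reduces

variable {A : Set Alignment} {d : Datum} {f : AffineForm} {s : Circle → Alignment}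
  (h : Reduces A d f s)
include h

theorem mem_minimizers_iff {a : Alignment} : a ∈ minimizers A d ↔ a ∈ A ∧ a.rot ∈ f.circleMin := by
  refine and_congr_right fun ha => ⟨fun hmin ρ => ?_, fun hmin a' ha' => ?_⟩
  · have := hmin (s ρ) (h.section_mem ρ)
    rwa [h.res_eq a ha, h.res_eq _ (h.section_mem ρ), h.rot_section] at this
  · rw [h.res_eq a ha, h.res_eq a' ha']
    exact hmin a'.rot

theorem section_mem_minimizers {ρ : Circle} (hρ : ρ ∈ f.circleMin) : s ρ ∈ minimizers A d :=
  h.mem_minimizers_iff.2 ⟨h.section_mem ρ, (h.rot_section ρ).symm ▸ hρ⟩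

theorem image_fst_minimizers : Prod.fst '' minimizers A d = rotationEquiv.symm '' f.circleMin := by
  ext R
  rw [rotationEquiv.symm.image_eq_preimage_symm, Set.mem_preimage, Equiv.symm_symm]
  constructor
  · rintro ⟨a, ha, rfl⟩
    exact (h.mem_minimizers_iff.1 ha).2
  · intro hR
    exact ⟨_, h.section_mem_minimizers hR, rotationEquiv.injective (h.rot_section _)⟩

theorem finite_image_fst_minimizers_iff : (Prod.fst '' minimizers A d).Finite ↔ f.1 ≠ 0 := by
  rw [h.image_fst_minimizers, Set.finite_image_iff rotationEquiv.symm.injective.injOn,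
    AffineForm.circleMin_finite_iff]

theorem isSelectionPerRotation_map_circleMinimizers :
    IsSelectionPerRotation (minimizers A d) {a | a ∈ f.circleMinimizers.map s} := by
  rw [isSelectionPerRotation_iff]
  rcases eq_or_ne f.1 0 with hf | hf
  · refine .inr ⟨fun hfin => h.finite_image_fst_minimizers_iff.1 hfin hf, s 1, ?_, ?_⟩
    · exact h.section_mem_minimizers (AffineForm.circleMin_eq_univ hf ▸ Set.mem_univ 1)
    · rw [AffineForm.circleMinimizers_of_eq_zero hf]
      simp
  · have hsub : {a | a ∈ f.circleMinimizers.map s} ⊆ minimizers A d := by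
      intro a ha
      obtain ⟨ρ, hρ, rfl⟩ := List.mem_map.1 ha
      exact h.section_mem_minimizers ((AffineForm.mem_circleMinimizers hf).1 hρ)
    refine .inl ⟨h.finite_image_fst_minimizers_iff.2 hf, hsub,
      fun a ha => ⟨a, hsub ha, rfl⟩, fun a ha a' ha' heq => ?_, ?_⟩
    · obtain ⟨ρ, -, rfl⟩ := List.mem_map.1 ha
      obtain ⟨ρ', -, rfl⟩ := List.mem_map.1 ha'
      rw [Alignment.fst_eq_iff, h.rot_section, h.rot_section] at heq
      rw [heq]
    · rw [h.image_fst_minimizers]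
      rintro _ ⟨ρ, hρ, rfl⟩
      have hmem : s ρ ∈ f.circleMinimizers.map s :=
        List.mem_map_of_mem ((AffineForm.mem_circleMinimizers hf).2 hρ)
      exact ⟨s ρ, hmem, rotationEquiv.eq_symm_apply.2 (h.rot_section ρ)⟩

theorem minimizers_nonempty : (minimizers A d).Nonempty :=
  let ⟨ρ, hρ⟩ := f.circleMin_nonempty
  ⟨s ρ, h.section_mem_minimizers hρ⟩

theorem circleMin_subset_image_rot {S : Set Alignment}
    (hS : IsSelectionPerRotation (minimizers A d) S) (hf : f.1 ≠ 0) :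
    f.circleMin ⊆ Alignment.rot '' S := by
  rcases isSelectionPerRotation_iff.1 hS with ⟨-, -, hbij⟩ | ⟨hinf, -⟩
  · intro ρ hρ
    obtain ⟨a, ha, heq⟩ := hbij.surjOn ⟨s ρ, h.section_mem_minimizers hρ, rfl⟩
    exact ⟨a, ha, (Alignment.fst_eq_iff.1 heq).trans (h.rot_section ρ)⟩
  · exact absurd (h.finite_image_fst_minimizers_iff.2 hf) hinf

theorem finite_and_ncard_le {S : Set Alignment} (hS : IsSelectionPerRotation (minimizers A d) S) :
    S.Finite ∧ S.ncard ≤ 2 := by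
  rcases isSelectionPerRotation_iff.1 hS with ⟨hfin, -, hbij⟩ | ⟨-, a, -, rfl⟩
  · refine ⟨hbij.finite_iff_finite.2 hfin, ?_⟩
    have hf := h.finite_image_fst_minimizers_iff.1 hfin
    rw [← hbij.injOn.ncard_image, hbij.image_eq, h.image_fst_minimizers,
      Set.ncard_image_of_injective _ rotationEquiv.symm.injective, AffineForm.circleMin_eq hf]
    exact (Set.ncard_insert_le _ _).trans_eq (congrArg (· + 1) (Set.ncard_singleton _))
  · exact ⟨Set.finite_singleton a, (Set.ncard_singleton a).trans_le one_le_two⟩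

end Reduces

/-! ### The configurations of Z-Configs -/

theorem inner_sq_add_inner_I_mul_sq (z w : ℂ) :
    ⟪z, w⟫ ^ 2 + ⟪I * z, w⟫ ^ 2 = ‖z‖ ^ 2 * ‖w‖ ^ 2 := by
  simp only [← Complex.normSq_eq_norm_sq, Complex.normSq_apply, inner_eq_re_add_im,
    Complex.I_mul_re, Complex.I_mul_im]
  ring

theorem inner_div_add_inner_div_mul_I (z w : ℂ) :
    ((⟪w, z⟫ / ‖w‖ ^ 2 : ℝ) : ℂ) + (⟪I * w, z⟫ / ‖w‖ ^ 2 : ℝ) * I = z / w := by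
  have hre : (z / w).re = ⟪w, z⟫ / ‖w‖ ^ 2 := by
    rw [Complex.div_re, Complex.normSq_eq_norm_sq, inner_eq_re_add_im]
    ring
  have him : (z / w).im = ⟪I * w, z⟫ / ‖w‖ ^ 2 := by
    rw [Complex.div_im, Complex.normSq_eq_norm_sq, inner_eq_re_add_im, Complex.I_mul_re,
      Complex.I_mul_im]
    ring
  rw [← hre, ← him, Complex.re_add_im]

theorem act_mul (M N : Matrix (Fin 2) (Fin 2) ℝ) (x : Plane) :
    act (M * N) x = act M (act N x) :=
  congrArg (WithLp.toLp 2) (Matrix.mulVec_mulVec _ M N).symm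

theorem act_add (M N : Matrix (Fin 2) (Fin 2) ℝ) (x : Plane) :
    act (M + N) x = act M x + act N x :=
  congrArg (WithLp.toLp 2) (Matrix.add_mulVec M N _)

theorem act_sub (M N : Matrix (Fin 2) (Fin 2) ℝ) (x : Plane) :
    act (M - N) x = act M x - act N x :=
  congrArg (WithLp.toLp 2) (Matrix.sub_mulVec M N _)

theorem act_smul (c : ℝ) (M : Matrix (Fin 2) (Fin 2) ℝ) (x : Plane) :
    act (c • M) x = c • act M x :=
  congrArg (WithLp.toLp 2) (Matrix.smul_mulVec c M _)

theorem toComplex_act_J (x : Plane) : toComplex (act J x) = I * toComplex x := by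
  simpa [J] using toComplex_act_conformal I x

theorem toComplex_dirOf (v : Plane) : toComplex (dirOf v) = -I * toComplex v := by
  simpa [J, dirOf] using toComplex_act_conformal (-I) v

theorem rotOf_eq (v : Plane) : rotOf v = !![v 1, -v 0; v 0, v 1] := by
  simp [rotOf, ← toComplex_re (dirOf v), ← toComplex_im (dirOf v), toComplex_dirOf]

theorem toComplex_act_rotOf_dirOf (v v' : Plane) :
    toComplex (act (rotOf v) (dirOf v')) = conj (toComplex v) * toComplex v' := by
  have h := toComplex_act_conformal (I * conj (toComplex v)) (dirOf v')
  rw [toComplex_dirOf] at h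
  rw [rotOf_eq]
  convert h using 1
  · simp
  · linear_combination (conj (toComplex v) * toComplex v') * Complex.I_mul_I

theorem toComplex_act_transpose_rotOf (v x : Plane) :
    toComplex (act (rotOf v)ᵀ x) = -I * toComplex v * toComplex x := by
  have htranspose : (rotOf v)ᵀ = !![v 1, v 0; -v 0, v 1] := by
    rw [rotOf_eq, ← Matrix.etaExpand_eq (!![_, _; _, _]ᵀ)]
    rfl
  simpa [htranspose] using toComplex_act_conformal (-I * toComplex v) x

section

variable (w p q z x : Plane)

theorem toComplex_act_zConfigs_fst :
    toComplex (act (zConfigs w p q z).1 x) = (‖p - q‖ * (w 0 / w 1 * x 0 + x 1) : ℝ) := by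
  apply Complex.ext <;> simp [zConfigs, act_apply, mul_add, mul_assoc]

theorem toComplex_act_zConfigs_snd_fst (hw : w 1 ≠ 0) :
    toComplex (act (zConfigs w p q z).2.1 x) = (‖p - q‖ * (x 0 / w 1) : ℝ) * toComplex w := by
  apply Complex.ext
  · simp [zConfigs, act_apply, mul_assoc, div_mul_eq_mul_div, mul_div_assoc, mul_comm (x 0)]
  · simp [zConfigs, act_apply, mul_assoc, hw]

theorem toComplex_act_zConfigs_snd_fst_sub :
    toComplex (act (zConfigs w p q z).2.1 x) - toComplex (act (zConfigs w p q z).1 x) =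
      I * ‖p - q‖ * toComplex x := by
  apply Complex.ext <;> simp [zConfigs, act_apply]

theorem act_zConfigs_snd_snd_of_eq (hpq : p = q) :
    act (zConfigs w p q z).2.2 x = ‖p - z‖ • x := by
  simp only [zConfigs, if_pos hpq, act_smul]
  simp [act]

variable {p q} (hpq : p ≠ q)
include hpq

theorem inner_div_norm_eq :
    (‖p - q‖ ^ 2 + ‖p - z‖ ^ 2 - ‖q - z‖ ^ 2) / (2 * ‖p - q‖) =
      inner ℝ (z - p) (q - p) / ‖p - q‖ := by
  have hr : ‖p - q‖ ≠ 0 := norm_ne_zero_iff.2 (sub_ne_zero.2 hpq)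
  have hcos : ‖q - z‖ ^ 2 = ‖p - z‖ ^ 2 - 2 * inner ℝ (z - p) (q - p) + ‖p - q‖ ^ 2 := by
    rw [norm_sub_rev p z, norm_sub_rev p q, ← norm_sub_sq_real, sub_sub_sub_cancel_right,
      norm_sub_rev]
  rw [hcos]
  field_simp
  ring

theorem sqrt_abs_sub_sq_eq :
    √|‖p - z‖ ^ 2 - (inner ℝ (z - p) (q - p) / ‖p - q‖) ^ 2| =
      |inner ℝ (z - p) (act J (q - p))| / ‖p - q‖ := by
  have hr : 0 < ‖p - q‖ := norm_pos_iff.2 (sub_ne_zero.2 hpq)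
  have hpythagoras : ‖p - z‖ ^ 2 - (inner ℝ (z - p) (q - p) / ‖p - q‖) ^ 2 =
      (inner ℝ (z - p) (act J (q - p)) / ‖p - q‖) ^ 2 := by
    have h := inner_sq_add_inner_I_mul_sq (toComplex (q - p)) (toComplex (z - p))
    rw [← toComplex_act_J, toComplex.inner_map_map, toComplex.inner_map_map, toComplex.norm_map,
      toComplex.norm_map, real_inner_comm (z - p), real_inner_comm (z - p), norm_sub_rev q,
      norm_sub_rev z] at h
    field_simp
    linarith
  rw [hpythagoras, abs_sq, Real.sqrt_sq_eq_abs, abs_div, abs_of_pos hr]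

theorem toComplex_act_zConfigs_snd_snd_sub :
    toComplex (act (zConfigs w p q z).2.2 x) - toComplex (act (zConfigs w p q z).1 x) =
      toComplex (z - p) / toComplex (q - p) * (I * ‖p - q‖ * toComplex x) := by
  have hsign : (open Classical in if 0 < inner ℝ (z - p) (act J (q - p)) then (1 : ℝ) else -1) *
      |inner ℝ (z - p) (act J (q - p))| = inner ℝ (z - p) (act J (q - p)) := by
    split_ifs with h
    · rw [abs_of_pos h, one_mul]
    · rw [abs_of_nonpos (not_lt.1 h), neg_one_mul, neg_neg]
  have hZ : (zConfigs w p q z).2.2 = (zConfigs w p q z).1 +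
      (inner ℝ (z - p) (q - p) / ‖p - q‖ ^ 2) • ((zConfigs w p q z).2.1 - (zConfigs w p q z).1) +
      (inner ℝ (z - p) (act J (q - p)) / ‖p - q‖ ^ 2) •
        (J * ((zConfigs w p q z).2.1 - (zConfigs w p q z).1)) := by
    simp only [zConfigs, if_neg hpq]
    rw [inner_div_norm_eq z hpq, sqrt_abs_sub_sq_eq z hpq, div_div, div_div, mul_div_assoc',
      hsign, ← sq]
  rw [hZ, act_add, act_add, act_smul, act_smul, act_mul, act_sub, map_add, map_add, map_smul,
    map_smul, toComplex_act_J, map_sub, toComplex_act_zConfigs_snd_fst_sub,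
    ← inner_div_add_inner_div_mul_I, ← toComplex_act_J, toComplex.inner_map_map,
    toComplex.inner_map_map, toComplex.norm_map, real_inner_comm (z - p) (q - p),
    real_inner_comm (z - p) (act J _), norm_sub_rev q, Complex.real_smul, Complex.real_smul]
  ring

end

/-- The complex numbers `P x`, `Q x`, `Z x` for the matrices `P`, `Q`, `Z` that Align computes from
the normals `v`, `v'` and the points `p`, `q`, `z`. -/
def config (v v' p q z x : Plane) : ℂ × ℂ × ℂ :=
  let PQZ := zConfigs (act (rotOf v) (dirOf v')) p q z
  (toComplex (act ((rotOf v)ᵀ * PQZ.1) x), toComplex (act ((rotOf v)ᵀ * PQZ.2.1) x),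
    toComplex (act ((rotOf v)ᵀ * PQZ.2.2) x))

section Config

variable (v v' p q z x : Plane)

theorem inner_config_fst : ⟪toComplex v, (config v v' p q z x).1⟫ = 0 := by
  rw [config, act_mul, toComplex_act_transpose_rotOf, toComplex_act_zConfigs_fst, mul_right_comm]
  exact inner_mul_self_of_re_eq_zero (by simp) _

theorem inner_config_snd_fst (hdet : (conj (toComplex v) * toComplex v').im ≠ 0) :
    ⟪toComplex v', (config v v' p q z x).2.1⟫ = 0 := by
  have hw : act (rotOf v) (dirOf v') 1 ≠ 0 := by
    rwa [← toComplex_im, toComplex_act_rotOf_dirOf]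
  simp only [config, act_mul, toComplex_act_transpose_rotOf,
    toComplex_act_zConfigs_snd_fst _ _ _ _ _ hw, toComplex_act_rotOf_dirOf]
  set c : ℝ := ‖p - q‖ * (x 0 / act (rotOf v) (dirOf v') 1)
  have hnormal : -I * toComplex v * (c * (conj (toComplex v) * toComplex v')) =
      -I * (Complex.normSq (toComplex v) * c : ℝ) * toComplex v' := by
    rw [Complex.ofReal_mul (Complex.normSq _), ← Complex.mul_conj]
    ring
  rw [hnormal]
  exact inner_mul_self_of_re_eq_zero (by simp) _

theorem config_snd_fst_sub_fst :
    (config v v' p q z x).2.1 - (config v v' p q z x).1 =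
      toComplex v * (‖p - q‖ * toComplex x) := by
  simp only [config, act_mul, toComplex_act_transpose_rotOf]
  rw [← mul_sub, toComplex_act_zConfigs_snd_fst_sub]
  linear_combination (-toComplex v * ‖p - q‖ * toComplex x) * Complex.I_mul_I

theorem config_snd_snd_sub_fst_of_ne (hpq : p ≠ q) :
    (config v v' p q z x).2.2 - (config v v' p q z x).1 =
      toComplex (z - p) / toComplex (q - p) * (toComplex v * (‖p - q‖ * toComplex x)) := by
  simp only [config, act_mul, toComplex_act_transpose_rotOf]
  rw [← mul_sub, toComplex_act_zConfigs_snd_snd_sub _ _ _ hpq]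
  linear_combination (-toComplex v * (toComplex (z - p) / toComplex (q - p)) * ‖p - q‖ *
    toComplex x) * Complex.I_mul_I

theorem config_snd_snd_sub_fst_of_eq (hpq : p = q) :
    (config v v' p q z x).2.2 - (config v v' p q z x).1 =
      -I * toComplex v * (‖p - z‖ * toComplex x) := by
  simp only [config, act_mul, toComplex_act_transpose_rotOf]
  rw [act_zConfigs_snd_snd_of_eq _ _ _ _ _ hpq, toComplex_act_zConfigs_fst, hpq, sub_self,
    norm_zero, zero_mul, Complex.ofReal_zero, mul_zero, sub_zero, map_smul, Complex.real_smul]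

theorem exists_circle_mul_norm_eq {η : ℂ} (hη : ‖η‖ = 1) (ζ : ℂ) :
    ∃ c : Circle, ∀ ρ : Circle, (ρ : ℂ) * ζ = η * (‖ζ‖ * (c * ρ : Circle)) := by
  obtain ⟨e, rfl⟩ : ∃ e : Circle, (e : ℂ) = η := ⟨⟨η, mem_sphere_zero_iff_norm.2 hη⟩, rfl⟩
  refine ⟨Circle.exp ζ.arg * e⁻¹, fun ρ => ?_⟩
  have he := Circle.coe_ne_zero e
  rw [Circle.coe_mul, Circle.coe_mul, Circle.coe_inv, Circle.coe_exp]
  nth_rw 1 [← Complex.norm_mul_exp_arg_mul_I ζ]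
  field_simp

theorem exists_circle_config (hv : ‖v‖ = 1) :
    ∃ c : Circle, ∀ (ρ : Circle) (x : Plane), toComplex x = (c * ρ : Circle) →
      (config v v' p q z x).2.1 - (config v v' p q z x).1 = ρ * toComplex (q - p) ∧
        (config v v' p q z x).2.2 - (config v v' p q z x).1 = ρ * toComplex (z - p) := by
  have hν : ‖toComplex v‖ = 1 := (toComplex.norm_map v).trans hv
  rcases eq_or_ne p q with hpq | hpq
  · have hη : ‖-I * toComplex v‖ = 1 := by rw [norm_mul, norm_neg, Complex.norm_I, hν, one_mul]
    obtain ⟨c, hc⟩ := exists_circle_mul_norm_eq hη (toComplex (z - p))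
    refine ⟨c, fun ρ x hx => ⟨?_, ?_⟩⟩
    · rw [config_snd_fst_sub_fst, hpq]
      simp
    · rw [config_snd_snd_sub_fst_of_eq _ _ _ _ _ _ hpq, hx, hc, toComplex.norm_map,
        norm_sub_rev z]
  · obtain ⟨c, hc⟩ := exists_circle_mul_norm_eq hν (toComplex (q - p))
    have hq : toComplex (q - p) ≠ 0 :=
      (map_ne_zero_iff _ toComplex.injective).2 (sub_ne_zero.2 hpq.symm)
    refine ⟨c, fun ρ x hx => ?_⟩
    rw [config_snd_fst_sub_fst, config_snd_snd_sub_fst_of_ne _ _ _ _ _ _ hpq, hx, norm_sub_rev p,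
      ← toComplex.norm_map (q - p), ← hc]
    exact ⟨rfl, by field_simp⟩

end Config

/-! ### The alignments chosen by Align as minimizers -/

theorem Datum.eq_add_and_eq_add {d₁ d₂ : Datum} (hdet : d₁.det d₂ ≠ 0) {s c₁ c₂ q₁ q₂ : ℂ}
    (hs₁ : ⟪d₁.normal, s⟫ = d₁.offset) (hs₂ : ⟪d₂.normal, s⟫ = d₂.offset)
    (hc₁ : ⟪d₁.normal, c₁⟫ = 0) (hc₂ : ⟪d₂.normal, c₂⟫ = 0)
    (hq₁ : ⟪d₁.normal, q₁⟫ = d₁.offset) (hq₂ : ⟪d₂.normal, q₂⟫ = d₂.offset)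
    (hsub : c₂ - c₁ = q₂ - q₁) : q₁ = s + c₁ ∧ q₂ = s + c₂ := by
  have hq₁' : q₁ - c₁ = q₂ - c₂ := by linear_combination hsub
  have hs : q₁ - c₁ = s := by
    apply eq_of_inner_eq hdet
    · rw [inner_sub_right, hq₁, hc₁, hs₁, sub_zero]
    · rw [hq₁', inner_sub_right, hq₂, hc₂, hs₂, sub_zero]
  exact ⟨by rw [← hs, sub_add_cancel], by rw [← hs, hq₁', sub_add_cancel]⟩

theorem Datum.Describes.det_ne_zero_iff {d₁ d₂ : Datum} {p₁ p₂ : Plane}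
    {ℓ₁ ℓ₂ : AffineSubspace ℝ Plane} (h₁ : d₁.Describes p₁ ℓ₁) (h₂ : d₂.Describes p₂ ℓ₂) :
    d₁.det d₂ ≠ 0 ↔ ∃! s, s ∈ ℓ₁ ∧ s ∈ ℓ₂ := by
  simp only [h₁.mem_line_iff, h₂.mem_line_iff]
  constructor
  · intro hdet
    obtain ⟨z, hz₁, hz₂⟩ := Frame.exists_inner_eq hdet d₁.offset d₂.offset
    refine ⟨toComplex.symm z, ⟨?_, ?_⟩, fun s ⟨hs₁, hs₂⟩ => ?_⟩
    · rwa [toComplex.apply_symm_apply]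
    · rwa [toComplex.apply_symm_apply]
    · exact (toComplex.eq_symm_apply).2
        (Datum.eq_of_inner_eq hdet (hs₁.trans hz₁.symm) (hs₂.trans hz₂.symm))
  · rintro ⟨s, ⟨hs₁, hs₂⟩, huniq⟩ hdet
    have hs := huniq (s + toComplex.symm (I * d₁.normal)) (by
      simp only [map_add, toComplex.apply_symm_apply, inner_add_right, hs₁, hs₂,
        inner_mul_self_of_re_eq_zero Complex.I_re, real_inner_comm (I * d₁.normal),
        ← Datum.det_eq_inner_I_mul, hdet, add_zero, and_self])
    rw [add_eq_left, map_eq_zero_iff _ toComplex.symm.injective, mul_eq_zero] at hs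
    exact hs.elim Complex.I_ne_zero h₁.normal_ne_zero

/-- The alignments that Align chooses from for the data of a triple of pairs: if the first two lines
are not parallel, these alignments put the first two points on their lines and bring the third as
close to its line as possible; otherwise, they put the first point on its line and bring the second
as close to its line as possible. -/
def candidates (d₁ d₂ d₃ : Datum) : Set Alignment :=
  open Classical in
  if d₁.det d₂ = 0 then minimizers {a | d₁.res a = 0} d₂
  else minimizers {a | d₁.res a = 0 ∧ d₂.res a = 0} d₃

theorem injOn_fst_candidates {d₁ d₂ : Datum} (hdet : d₁.det d₂ ≠ 0) (d₃ : Datum) :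
    (candidates d₁ d₂ d₃).InjOn Prod.fst := by
  rw [candidates, if_neg hdet]
  rintro a ⟨⟨h₁, h₂⟩, -⟩ a' ⟨⟨h₁', h₂'⟩, -⟩ heq
  rw [Frame.align_cross_of_res_eq_zero hdet h₁ h₂, Frame.align_cross_of_res_eq_zero hdet h₁' h₂',
    Alignment.fst_eq_iff.1 heq]

theorem candidates_congr {d₁ d₂ d₃ d₁' d₂' d₃' : Datum} {p₁ p₂ p₃ : Plane}
    {ℓ₁ ℓ₂ ℓ₃ : AffineSubspace ℝ Plane} (h₁ : d₁.Describes p₁ ℓ₁) (h₂ : d₂.Describes p₂ ℓ₂)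
    (h₃ : d₃.Describes p₃ ℓ₃) (h₁' : d₁'.Describes p₁ ℓ₁) (h₂' : d₂'.Describes p₂ ℓ₂)
    (h₃' : d₃'.Describes p₃ ℓ₃) : candidates d₁ d₂ d₃ = candidates d₁' d₂' d₃' := by
  have hdet : d₁.det d₂ = 0 ↔ d₁'.det d₂' = 0 := by
    rw [← not_iff_not, ← ne_eq, ← ne_eq, h₁.det_ne_zero_iff h₂, h₁'.det_ne_zero_iff h₂']
  simp only [candidates, hdet, minimizers, ← h₁.app_mem_iff, ← h₁'.app_mem_iff,
    ← h₂.app_mem_iff, ← h₂'.app_mem_iff, ← h₂.lineDist_app_le_iff, ← h₂'.lineDist_app_le_iff,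
    ← h₃.lineDist_app_le_iff, ← h₃'.lineDist_app_le_iff]

section Lines

variable {n : ℕ} {p : Fin n → Plane} {ℓ : Fin n → AffineSubspace ℝ Plane} {v : Fin n → Plane}
  {b : Fin n → ℝ}

/-- The data of the pairs `(p i, ℓ i)` for lines in normal form. -/
def normalDatum (p v : Fin n → Plane) (b : Fin n → ℝ) (i : Fin n) : Datum :=
  ⟨toComplex (p i), toComplex (v i), b i⟩

namespace IsNormalForm

variable (h : IsNormalForm ℓ v b)
include h

variable (p) in
theorem describes (i : Fin n) : (normalDatum p v b i).Describes (p i) (ℓ i) where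
  point_eq := rfl
  normal_ne_zero := norm_ne_zero_iff.1 <| by
    rw [normalDatum, toComplex.norm_map, (h i).1]
    exact one_ne_zero
  mem_line_iff q := by
    rw [← SetLike.mem_coe, (h i).2.2, normalDatum, toComplex.inner_map_map, Set.mem_ofPred_eq]

variable (p) in
theorem abs_inner_eq_one_iff (j k : Fin n) :
    |inner ℝ (v j) (v k)| = 1 ↔ (normalDatum p v b j).det (normalDatum p v b k) = 0 := by
  have hsq := inner_sq_add_inner_I_mul_sq (toComplex (v j)) (toComplex (v k))
  rw [toComplex.inner_map_map, toComplex.norm_map, toComplex.norm_map, (h j).1, (h k).1, one_pow,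
    one_mul] at hsq
  rw [Datum.det_eq_inner_I_mul, abs_eq zero_le_one, ← sq_eq_one_iff, normalDatum, normalDatum,
    ← sq_eq_zero_iff (a := ⟪_, _⟫)]
  constructor <;> intro <;> linarith

theorem inner_act_sub_eq_res {l : Fin n} {a : Alignment} {s y : Plane}
    {M : Matrix (Fin 2) (Fin 2) ℝ} (ha : a.app (p l) = s + act M y) :
    inner ℝ (v l) (act M y) - (b l - inner ℝ (v l) s) = (normalDatum p v b l).res a := by
  rw [(h.describes p l).res_eq, ha, normalDatum, toComplex.inner_map_map, inner_add_right]
  ring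

variable {j k : Fin n} (hdet : (normalDatum p v b j).det (normalDatum p v b k) ≠ 0)
include hdet

theorem exists_circle_app_eq {s : Plane} (hsj : s ∈ ℓ j) (hsk : s ∈ ℓ k) (l : Fin n) :
    ∃ c : Circle, ∀ (a : Alignment) (x : Plane),
      (normalDatum p v b j).res a = 0 → (normalDatum p v b k).res a = 0 →
      toComplex x = (c * a.rot : Circle) →
        let PQZ := zConfigs (act (rotOf (v j)) (dirOf (v k))) (p j) (p k) (p l)
        a.app (p j) = s + act ((rotOf (v j))ᵀ * PQZ.1) x ∧
        a.app (p k) = s + act ((rotOf (v j))ᵀ * PQZ.2.1) x ∧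
        a.app (p l) = s + act ((rotOf (v j))ᵀ * PQZ.2.2) x := by
  obtain ⟨c, hc⟩ := exists_circle_config (v j) (v k) (p j) (p k) (p l) (h j).1
  refine ⟨c, fun a x hja hka hx => ?_⟩
  obtain ⟨hkj, hlj⟩ := hc a.rot x hx
  have app_sub (i : Fin n) : toComplex (a.app (p i)) - toComplex (a.app (p j)) =
      a.rot * toComplex (p i - p j) := by
    rw [Alignment.toComplex_app, Alignment.toComplex_app, map_sub]
    ring
  obtain ⟨happ_j, happ_k⟩ := Datum.eq_add_and_eq_add hdet
    (((h.describes p j).mem_line_iff s).1 hsj) (((h.describes p k).mem_line_iff s).1 hsk)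
    (inner_config_fst _ _ _ _ _ x) (inner_config_snd_fst _ _ _ _ (p l) x hdet)
    (((h.describes p j).mem_line_iff _).1 (((h.describes p j).app_mem_iff a).2 hja))
    (((h.describes p k).mem_line_iff _).1 (((h.describes p k).app_mem_iff a).2 hka))
    (hkj.trans (app_sub k).symm)
  have happ_l : toComplex (a.app (p l)) =
      toComplex s + (config (v j) (v k) (p j) (p k) (p l) x).2.2 := by
    linear_combination app_sub l - hlj + happ_j
  refine ⟨toComplex.injective ?_, toComplex.injective ?_, toComplex.injective ?_⟩ <;>
    rwa [map_add]

variable (l : Fin n)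

theorem crossing_subset_minimizers :
    crossing p ℓ v b j k l ⊆
      minimizers {a | (normalDatum p v b j).res a = 0 ∧ (normalDatum p v b k).res a = 0}
        (normalDatum p v b l) := by
  rintro a ⟨s, x, hsj, hsk, -, hmin, hja, hka, hla⟩
  obtain ⟨c, hc⟩ := h.exists_circle_app_eq hdet hsj hsk l
  refine ⟨⟨?_, ?_⟩, fun a' ⟨hja', hka'⟩ => ?_⟩
  · rw [(h.describes p j).res_eq, hja, map_add, inner_add_right,
      ((h.describes p j).mem_line_iff s).1 hsj, add_sub_cancel_left]
    exact inner_config_fst _ _ _ _ _ x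
  · rw [(h.describes p k).res_eq, hka, map_add, inner_add_right,
      ((h.describes p k).mem_line_iff s).1 hsk, add_sub_cancel_left]
    exact inner_config_snd_fst _ _ _ _ _ x hdet
  · set y := toComplex.symm (c * a'.rot : Circle)
    have hy : toComplex y = (c * a'.rot : Circle) := toComplex.apply_symm_apply _
    obtain ⟨-, -, hla'⟩ := hc a' y hja' hka' hy
    rw [← h.inner_act_sub_eq_res hla, ← h.inner_act_sub_eq_res hla']
    exact hmin y (by rw [← toComplex.norm_map, hy, Circle.norm_coe])

theorem minimizers_subset_crossing :
    minimizers {a | (normalDatum p v b j).res a = 0 ∧ (normalDatum p v b k).res a = 0}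
        (normalDatum p v b l) ⊆ crossing p ℓ v b j k l := by
  rintro a ⟨⟨hja, hka⟩, hmin⟩
  obtain ⟨s, ⟨hsj, hsk⟩, -⟩ := ((h.describes p j).det_ne_zero_iff (h.describes p k)).1 hdet
  obtain ⟨c, hc⟩ := h.exists_circle_app_eq hdet hsj hsk l
  set x := toComplex.symm (c * a.rot : Circle)
  have hx : toComplex x = (c * a.rot : Circle) := toComplex.apply_symm_apply _
  obtain ⟨happ_j, happ_k, happ_l⟩ := hc a x hja hka hx
  refine ⟨s, x, hsj, hsk, by rw [← toComplex.norm_map, hx, Circle.norm_coe], fun y hy => ?_,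
    happ_j, happ_k, happ_l⟩
  obtain ⟨ρ, hρ⟩ : ∃ ρ : Circle, (ρ : ℂ) = toComplex y :=
    ⟨⟨toComplex y, mem_sphere_zero_iff_norm.2 ((toComplex.norm_map y).trans hy)⟩, rfl⟩
  have hreduces := Frame.reduces_cross hdet (normalDatum p v b l)
  obtain ⟨hja', hka'⟩ := hreduces.section_mem (c⁻¹ * ρ)
  obtain ⟨-, -, happ_l'⟩ := hc _ y hja' hka' (by rw [hreduces.rot_section, mul_inv_cancel_left, hρ])
  rw [h.inner_act_sub_eq_res happ_l, h.inner_act_sub_eq_res happ_l']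
  exact hmin _ ⟨hja', hka'⟩

end IsNormalForm

namespace IsNormalForm

variable (h : IsNormalForm ℓ v b) (j k l : Fin n)
include h

theorem isSelection_crossing_iff (hdet : (normalDatum p v b j).det (normalDatum p v b k) ≠ 0)
    {S : Set Alignment} :
    IsSelection (crossing p ℓ v b j k l) S ↔
      IsSelectionPerRotation
        (candidates (normalDatum p v b j) (normalDatum p v b k) (normalDatum p v b l)) S := by
  rw [← isSelection_iff_isSelectionPerRotation (injOn_fst_candidates hdet _), candidates,
    if_neg hdet,
    (h.crossing_subset_minimizers hdet l).antisymm (h.minimizers_subset_crossing hdet l)]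

theorem sliding_eq_candidates (hdet : (normalDatum p v b j).det (normalDatum p v b k) = 0) :
    sliding p ℓ j k =
      candidates (normalDatum p v b j) (normalDatum p v b k) (normalDatum p v b l) := by
  rw [candidates, if_pos hdet]
  simp only [sliding, minimizers, (h.describes p j).app_mem_iff,
    (h.describes p k).lineDist_app_le_iff, Set.mem_ofPred_eq]

theorem selection_iff {S : Set Alignment} :
    ((|inner ℝ (v j) (v k)| ≠ 1 → IsSelection (crossing p ℓ v b j k l) S) ∧
      (|inner ℝ (v j) (v k)| = 1 → IsSelectionPerRotation (sliding p ℓ j k) S)) ↔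
      IsSelectionPerRotation
        (candidates (normalDatum p v b j) (normalDatum p v b k) (normalDatum p v b l)) S := by
  rw [ne_eq, h.abs_inner_eq_one_iff p]
  rcases eq_or_ne ((normalDatum p v b j).det (normalDatum p v b k)) 0 with hdet | hdet
  · simp only [hdet, not_true_eq_false, false_imp_iff, true_imp_iff, true_and,
      h.sliding_eq_candidates j k l hdet]
  · simp only [hdet, not_false_eq_true, false_imp_iff, true_imp_iff, and_true,
      h.isSelection_crossing_iff j k l hdet]

end IsNormalForm

theorem exists_isNormalForm {D : Fin n → Datum} (hD : ∀ i, (D i).Describes (p i) (ℓ i)) :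
    ∃ v b, IsNormalForm ℓ v b := by
  have exists_unit_normal (i : Fin n) : ∃ (v : Plane) (b : ℝ),
      ‖v‖ = 1 ∧ 0 ≤ b ∧ (ℓ i : Set Plane) = {q | inner ℝ v q = b} := by
    have hnorm : ‖(D i).normal‖ ≠ 0 := norm_ne_zero_iff.2 (hD i).normal_ne_zero
    obtain ⟨ε, hε, hoffset⟩ : ∃ ε : ℝ, |ε| = 1 ∧ ε * (D i).offset = |(D i).offset| := by
      rcases le_total 0 (D i).offset with h | h
      · exact ⟨1, abs_one, by rw [one_mul, abs_of_nonneg h]⟩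
      · exact ⟨-1, by rw [abs_neg, abs_one], by rw [neg_one_mul, abs_of_nonpos h]⟩
    have hε₀ : ε ≠ 0 := abs_ne_zero.1 (hε ▸ one_ne_zero)
    refine ⟨toComplex.symm ((ε / ‖(D i).normal‖) • (D i).normal), |(D i).offset| / ‖(D i).normal‖,
      ?_, by positivity, ?_⟩
    · rw [toComplex.symm.norm_map, norm_smul, norm_div, norm_norm, Real.norm_eq_abs, hε,
        one_div_mul_cancel hnorm]
    · ext q
      rw [SetLike.mem_coe, (hD i).mem_line_iff, Set.mem_ofPred_eq, ← toComplex.inner_map_map,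
        toComplex.apply_symm_apply, real_inner_smul_left, ← hoffset, div_mul_eq_mul_div,
        div_left_inj' hnorm, mul_right_inj' hε₀]
  choose v b h using exists_unit_normal
  exact ⟨v, b, h⟩

theorem isAlignOutput_iff {D : Fin n → Datum} (hD : ∀ i, (D i).Describes (p i) (ℓ i))
    {C : Set Alignment} :
    IsAlignOutput p ℓ C ↔ ∃ S : Fin n → Fin n → Fin n → Set Alignment,
      (∀ j k l, j ≠ k → IsSelectionPerRotation (candidates (D j) (D k) (D l)) (S j k l)) ∧
        C = {a | ∃ j k l, j ≠ k ∧ a ∈ S j k l} := by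
  have selection_iff {v : Fin n → Plane} {b : Fin n → ℝ} (h : IsNormalForm ℓ v b) (j k l : Fin n)
      (S : Set Alignment) :
      ((|inner ℝ (v j) (v k)| ≠ 1 → IsSelection (crossing p ℓ v b j k l) S) ∧
        (|inner ℝ (v j) (v k)| = 1 → IsSelectionPerRotation (sliding p ℓ j k) S)) ↔
        IsSelectionPerRotation (candidates (D j) (D k) (D l)) S := by
    rw [h.selection_iff, candidates_congr (h.describes p j) (h.describes p k) (h.describes p l)
      (hD j) (hD k) (hD l)]
  constructor
  · rintro ⟨v, b, S, h, hcross, hslide, hC⟩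
    exact ⟨S, fun j k l hjk =>
      (selection_iff h j k l _).1 ⟨hcross j k l hjk, hslide j k l hjk⟩, hC⟩
  · rintro ⟨S, hS, hC⟩
    obtain ⟨v, b, h⟩ := exists_isNormalForm hD
    exact ⟨v, b, S, h, fun j k l hjk => ((selection_iff h j k l _).2 (hS j k l hjk)).1,
      fun j k l hjk => ((selection_iff h j k l _).2 (hS j k l hjk)).2, hC⟩

end Lines

/-! ### The approximation guarantee -/

namespace Alignment

/-- The alignment `a`, followed by the translation by `-u`. -/
def shift (a : Alignment) (u : ℂ) : Alignment := ofComplex a.rot (toComplex a.2 + u)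

theorem res_shift (d : Datum) (a : Alignment) (u : ℂ) :
    d.res (a.shift u) = d.res a - ⟪d.normal, u⟫ := by
  rw [Datum.res, Datum.res, shift, rot_ofComplex, toComplex_snd_ofComplex, ← sub_sub,
    inner_sub_right]
  ring

end Alignment

section Guarantee

variable {ι : Type*} [Finite ι] {D : ι → Datum}

theorem exists_res_eq_zero_and_le_two_mul [Nonempty ι] (hD : ∀ i, ‖(D i).normal‖ = 1)
    (a : Alignment) :
    ∃ j a', (D j).res a' = 0 ∧ ∀ i, |(D i).res a'| ≤ 2 * |(D i).res a| := by
  obtain ⟨j, hj⟩ := Finite.exists_min fun i => |(D i).res a|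
  refine ⟨j, a.shift ((D j).res a • (D j).normal), ?_, fun i => ?_⟩
  · rw [Alignment.res_shift, real_inner_smul_right, real_inner_self_eq_norm_sq, hD, one_pow,
      mul_one, sub_self]
  · have hinner : |⟪(D i).normal, (D j).res a • (D j).normal⟫| ≤ |(D j).res a| := by
      refine (abs_real_inner_le_norm _ _).trans_eq ?_
      rw [norm_smul, hD, hD, one_mul, mul_one, Real.norm_eq_abs]
    rw [Alignment.res_shift]
    linarith [abs_sub ((D i).res a) ⟪(D i).normal, (D j).res a • (D j).normal⟫, hj i]

theorem exists_res_eq_zero_and_le_two_mul_of_res_eq_zero {j : ι} (hj : ∃ k, (D j).det (D k) ≠ 0)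
    {a : Alignment} (ha : (D j).res a = 0) :
    ∃ k a', (D j).det (D k) ≠ 0 ∧ (D j).res a' = 0 ∧ (D k).res a' = 0 ∧
      ∀ i, |(D i).res a'| ≤ 2 * |(D i).res a| := by
  obtain ⟨k, hk, hmin⟩ := {k | (D j).det (D k) ≠ 0}.exists_min_image
    (fun k => |(D k).res a / (D j).det (D k)|) (Set.toFinite _) hj
  have hres (i : ι) : (D i).res (a.shift (((D k).res a / (D j).det (D k)) • (I * (D j).normal))) =
      (D i).res a - (D k).res a / (D j).det (D k) * (D j).det (D i) := by
    rw [Alignment.res_shift, real_inner_smul_right, real_inner_comm, ← Datum.det_eq_inner_I_mul]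
  refine ⟨k, _, hk, ?_, ?_, fun i => (congrArg abs (hres i)).trans_le ?_⟩
  · rw [hres, ha, Datum.det_eq_inner_I_mul (D j) (D j), real_inner_comm,
      inner_mul_self_of_re_eq_zero Complex.I_re, mul_zero, sub_zero]
  · rw [hres, div_mul_cancel₀ _ hk, sub_self]
  · refine (abs_sub _ _).trans ?_
    rcases eq_or_ne ((D j).det (D i)) 0 with hi | hi
    · rw [hi, mul_zero, abs_zero]
      linarith [abs_nonneg ((D i).res a)]
    · have hle := mul_le_mul_of_nonneg_right (hmin i hi) (abs_nonneg ((D j).det (D i)))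
      rw [← abs_mul, ← abs_mul, div_mul_cancel₀ _ hi] at hle
      linarith

theorem exists_forall_mem_selection_le_four_mul [Nonempty ι] {A : Set Alignment}
    {f : ι → AffineForm} {s : ι → Circle → Alignment} (h : ∀ i, Reduces A (D i) (f i) (s i))
    {a : Alignment} (ha : a ∈ A) :
    ∃ i, ∀ S, IsSelectionPerRotation (minimizers A (D i)) S →
      ∃ a' ∈ S, a' ∈ A ∧ ∀ k, |(D k).res a'| ≤ 4 * |(D k).res a| := by
  obtain ⟨i, hi⟩ := AffineForm.exists_forall_abs_eval_le f a.rot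
  refine ⟨i, fun S hS => ?_⟩
  obtain ⟨_, ⟨a', ha', rfl⟩, hle⟩ := hi (Alignment.rot '' S)
    ((hS.nonempty (h i).minimizers_nonempty).image _) ((h i).circleMin_subset_image_rot hS)
  have hA : a' ∈ A := (hS.subset ha').1
  refine ⟨a', ha', hA, fun k => ?_⟩
  rw [(h k).res_eq a' hA, (h k).res_eq a ha]
  exact hle k

theorem exists_forall_mem_selection_le_sixteen_mul [Nontrivial ι]
    (hD : ∀ i, ‖(D i).normal‖ = 1) (a : Alignment) :
    ∃ j k l, j ≠ k ∧ ∀ S, IsSelectionPerRotation (candidates (D j) (D k) (D l)) S →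
      ∃ a' ∈ S, ∀ i, |(D i).res a'| ≤ 16 * |(D i).res a| := by
  obtain ⟨j, a₁, hj₁, hle₁⟩ := exists_res_eq_zero_and_le_two_mul hD a
  by_cases hj : ∃ k, (D j).det (D k) ≠ 0
  · obtain ⟨k, a₂, hdet, hj₂, hk₂, hle₂⟩ :=
      exists_res_eq_zero_and_le_two_mul_of_res_eq_zero hj hj₁
    obtain ⟨l, hl⟩ := exists_forall_mem_selection_le_four_mul
      (fun i => Frame.reduces_cross hdet (D i)) ⟨hj₂, hk₂⟩
    refine ⟨j, k, l, fun hjk => hdet ?_, fun S hS => ?_⟩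
    · rw [hjk, Datum.det_eq_inner_I_mul, real_inner_comm, inner_mul_self_of_re_eq_zero Complex.I_re]
    · rw [candidates, if_neg hdet] at hS
      obtain ⟨a', ha', -, hle⟩ := hl S hS
      exact ⟨a', ha', fun i => by linarith [hle i, hle₁ i, hle₂ i]⟩
  · rw [not_exists_not] at hj
    have hν : (D j).normal ≠ 0 := norm_ne_zero_iff.1 (hD j ▸ one_ne_zero)
    have : Nonempty {k // k ≠ j} := nonempty_subtype.2 (exists_ne j)
    obtain ⟨⟨k, hkj⟩, hk⟩ := exists_forall_mem_selection_le_four_mul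
      (fun i : {k // k ≠ j} => Frame.reduces_slide hν (hj i)) hj₁
    refine ⟨j, k, j, hkj.symm, fun S hS => ?_⟩
    rw [candidates, if_pos (hj k)] at hS
    obtain ⟨a', ha', hj', hle⟩ := hk S hS
    refine ⟨a', ha', fun i => ?_⟩
    rcases eq_or_ne i j with rfl | hij
    · rw [show (D i).res a' = 0 from hj', abs_zero]
      positivity
    · linarith [hle ⟨i, hij⟩, hle₁ i, abs_nonneg ((D i).res a)]

end Guarantee

theorem finite_and_ncard_le_of_isSelectionPerRotation {d₁ d₂ d₃ : Datum} (h₁ : d₁.normal ≠ 0)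
    {S : Set Alignment} (hS : IsSelectionPerRotation (candidates d₁ d₂ d₃) S) :
    S.Finite ∧ S.ncard ≤ 2 := by
  rw [candidates] at hS
  split_ifs at hS with hdet
  exacts [(Frame.reduces_slide h₁ hdet).finite_and_ncard_le hS,
    (Frame.reduces_cross hdet d₃).finite_and_ncard_le hS]

namespace IsAlignOutput

variable {n : ℕ} {p : Fin n → Plane} {ℓ : Fin n → AffineSubspace ℝ Plane} {C : Set Alignment}
  (hC : IsAlignOutput p ℓ C)
include hC

theorem exists_lineDist_le (hn : 2 ≤ n) (a' : Alignment) :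
    ∃ a ∈ C, ∀ i, lineDist (a.app (p i)) (ℓ i) ≤ 16 * lineDist (a'.app (p i)) (ℓ i) := by
  obtain ⟨v, b, -, h, -⟩ := id hC
  obtain ⟨S, hS, rfl⟩ := (isAlignOutput_iff (h.describes p)).1 hC
  have norm_normal (i : Fin n) : ‖(normalDatum p v b i).normal‖ = 1 :=
    (toComplex.norm_map (v i)).trans (h i).1
  have := Fin.nontrivial_iff_two_le.2 hn
  obtain ⟨j, k, l, hjk, hle⟩ := exists_forall_mem_selection_le_sixteen_mul norm_normal a'
  obtain ⟨a, ha, hle⟩ := hle _ (hS j k l hjk)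
  refine ⟨a, ⟨j, k, l, hjk, ha⟩, fun i => ?_⟩
  rw [(h.describes p i).lineDist_app, (h.describes p i).lineDist_app, norm_normal, div_one, div_one]
  exact hle i

theorem finite_and_ncard_le : C.Finite ∧ C.ncard ≤ 2 * n ^ 3 := by
  obtain ⟨v, b, -, h, -⟩ := id hC
  obtain ⟨S, hS, rfl⟩ := (isAlignOutput_iff (h.describes p)).1 hC
  set triples : Finset (Fin n × Fin n × Fin n) := {x | x.1 ≠ x.2.1}
  have card_triples : triples.card ≤ n ^ 3 := by
    refine (Finset.card_le_univ _).trans_eq ?_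
    simp only [Fintype.card_prod, Fintype.card_fin]
    ring
  have hunion : {a | ∃ j k l, j ≠ k ∧ a ∈ S j k l} = ⋃ x ∈ triples, S x.1 x.2.1 x.2.2 := by
    ext a
    simp [triples]
  have hsel (x) (hx : x ∈ triples) := finite_and_ncard_le_of_isSelectionPerRotation
    (h.describes p x.1).normal_ne_zero (hS x.1 x.2.1 x.2.2 (Finset.mem_filter.1 hx).2)
  rw [hunion]
  refine ⟨triples.finite_toSet.biUnion fun x hx => (hsel x hx).1, ?_⟩
  calc (⋃ x ∈ triples, S x.1 x.2.1 x.2.2).ncard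
      ≤ ∑ x ∈ triples, (S x.1 x.2.1 x.2.2).ncard := Finset.set_ncard_biUnion_le _ _
    _ ≤ triples.card • 2 := Finset.sum_le_card_nsmul _ _ _ fun x hx => (hsel x hx).2
    _ ≤ 2 * n ^ 3 := by
      rw [smul_eq_mul, mul_comm]
      exact Nat.mul_le_mul_left 2 card_triples

end IsAlignOutput

/-! ### Programs that halt within a given number of steps -/

/-- Started in `σ`, the program halts after at most `K` steps in a state that satisfies `Q`. -/
def Runs (c : Prog) (σ : State) (K : ℕ) (Q : State → Prop) : Prop :=
  ∃ k τ, Exec c σ k τ ∧ k ≤ K ∧ Q τ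

/-- A bound on the running time of a program without loops; the value at a loop is junk. -/
def Prog.bound : Prog → ℕ
  | .skip => 1
  | .setNat _ e => e.cost + 1
  | .setReal _ e => e.cost + 1
  | .store addr e => addr.cost + e.cost + 1
  | .seq c d => c.bound + d.bound
  | .cond t c d => t.cost + max c.bound d.bound
  | .loop _ _ => 0

namespace Runs

variable {σ : State} {Q Q' : State → Prop} {c d : Prog} {K K₁ K₂ : ℕ}

theorem mono (h : Runs c σ K₁ Q) (hK : K₁ ≤ K₂) (hQ : ∀ τ, Q τ → Q' τ) : Runs c σ K₂ Q' :=
  let ⟨k, τ, he, hk, hq⟩ := h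
  ⟨k, τ, he, hk.trans hK, hQ τ hq⟩

theorem skip (h : Q σ) : Runs .skip σ 1 Q := ⟨_, _, .skip σ, le_rfl, h⟩

theorem setNat {i : ℕ} {e : NExp} (h : Q { σ with nat := Function.update σ.nat i (e.eval σ) }) :
    Runs (.setNat i e) σ (e.cost + 1) Q :=
  ⟨_, _, .setNat i e σ, le_rfl, h⟩

theorem store {a : NExp} {e : RExp}
    (h : Q { σ with mem := Function.update σ.mem (a.eval σ) (e.eval σ) }) :
    Runs (.store a e) σ (a.cost + e.cost + 1) Q :=
  ⟨_, _, .store a e σ, le_rfl, h⟩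

theorem seq (hc : Runs c σ K₁ Q) (hd : ∀ τ, Q τ → Runs d τ K₂ Q') :
    Runs (.seq c d) σ (K₁ + K₂) Q' := by
  obtain ⟨k, τ, he, hk, hq⟩ := hc
  obtain ⟨m, υ, he', hm, hq'⟩ := hd τ hq
  exact ⟨_, _, .seq he he', add_le_add hk hm, hq'⟩

theorem cond {t : BExp} (hc : t.holds σ → Runs c σ K₁ Q) (hd : ¬ t.holds σ → Runs d σ K₂ Q) :
    Runs (.cond t c d) σ (t.cost + max K₁ K₂) Q := by
  by_cases ht : t.holds σ
  · obtain ⟨k, τ, he, hk, hq⟩ := hc ht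
    exact ⟨_, _, .condTrue ht he, Nat.add_le_add_left (le_max_of_le_left hk) _, hq⟩
  · obtain ⟨k, τ, he, hk, hq⟩ := hd ht
    exact ⟨_, _, .condFalse ht he, Nat.add_le_add_left (le_max_of_le_right hk) _, hq⟩

theorem loop_of_forall_lt {t : BExp} (P : ℕ → State → Prop) {n : ℕ}
    (htest : ∀ m τ, P m τ → (t.holds τ ↔ m < n))
    (hbody : ∀ m < n, ∀ τ, P m τ → Runs c τ K (P (m + 1)))
    {m : ℕ} (hm : m ≤ n) (hσ : P m σ) :
    Runs (.loop t c) σ ((n - m) * (t.cost + K) + t.cost) (P n) := by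
  induction hm using Nat.decreasingInduction generalizing σ with
  | self =>
    rw [Nat.sub_self, zero_mul, zero_add]
    exact ⟨_, σ, .loopFalse (mt (htest n σ hσ).1 (lt_irrefl n)), le_rfl, hσ⟩
  | of_succ m hm ih =>
    obtain ⟨k, τ, he, hk, hτ⟩ := hbody m hm σ hσ
    obtain ⟨k', υ, he', hk', hυ⟩ := ih hτ
    refine ⟨_, υ, .loopTrue ((htest m σ hσ).2 hm) he he', ?_, hυ⟩
    obtain ⟨r, rfl⟩ := Nat.exists_eq_add_of_lt hm
    rw [show m + r + 1 - (m + 1) = r by omega] at hk'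
    rw [show m + r + 1 - m = r + 1 by omega, Nat.succ_mul]
    omega

end Runs

/-- `for i in 0, …, n - 1 do c`, where `n` is in register `0`. -/
def forLoop (i : ℕ) (c : Prog) : Prog :=
  .seq (.setNat i (.const 0))
    (.loop (.natLt (.var i) (.var 0)) (.seq c (.setNat i (.add (.var i) (.const 1)))))

/-- Store the values of the expressions in consecutive cells. -/
def storeList (a : NExp) : List RExp → Prog
  | [] => .skip
  | e :: es => .seq (.store a e) (storeList (.add a (.const 1)) es)

/-- The entries of `xs` are in consecutive cells from `q` on. -/
def Stored (mem : ℕ → ℝ) (q : ℕ) (xs : List ℝ) : Prop :=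
  ∀ i (hi : i < xs.length), mem (q + i) = xs[i]

theorem Stored.congr {mem mem' : ℕ → ℝ} {q : ℕ} {xs : List ℝ} (h : Stored mem q xs)
    (hmem : ∀ r < q + xs.length, mem' r = mem r) : Stored mem' q xs := fun i hi =>
  (hmem _ (Nat.add_lt_add_left hi q)).trans (h i hi)

theorem NExp.eval_congr {σ τ : State} (h : σ.nat = τ.nat) (e : NExp) : e.eval σ = e.eval τ := by
  induction e with
  | const => rfl
  | var => rw [eval, eval, h]
  | add _ _ ih₁ ih₂ => rw [eval, eval, ih₁, ih₂]
  | sub _ _ ih₁ ih₂ => rw [eval, eval, ih₁, ih₂]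

theorem Runs.storeList {σ : State} {q : ℕ} (es : List RExp) (xs : List ℝ) {a : NExp}
    (ha : q ≤ a.eval σ)
    (hes : ∀ τ : State, τ.nat = σ.nat → (∀ r < q, τ.mem r = σ.mem r) → es.map (·.eval τ) = xs) :
    Runs (storeList a es) σ (storeList a es).bound fun τ =>
      τ.nat = σ.nat ∧ (∀ r < a.eval σ, τ.mem r = σ.mem r) ∧ Stored τ.mem (a.eval σ) xs := by
  induction es generalizing σ a xs with
  | nil =>
    obtain rfl := hes σ rfl fun _ _ => rfl
    exact skip ⟨rfl, fun _ _ => rfl, fun i hi => absurd hi (Nat.not_lt_zero i)⟩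
  | cons e es ih =>
    obtain rfl := hes σ rfl fun _ _ => rfl
    refine seq (Q := fun υ => υ.nat = σ.nat ∧ υ.mem = Function.update σ.mem (a.eval σ) (e.eval σ))
      (store ⟨rfl, rfl⟩) ?_
    rintro υ ⟨hυ_nat, hυ_mem⟩
    have haddr : (NExp.add a (.const 1)).eval υ = a.eval σ + 1 := NExp.eval_congr hυ_nat _
    have hυ_eq {r : ℕ} (hr : r < a.eval σ) : υ.mem r = σ.mem r := by
      rw [hυ_mem, Function.update_of_ne hr.ne]
    refine (ih (es.map (·.eval σ)) (haddr ▸ ha.trans (Nat.le_succ _)) fun τ hnat hmem => ?_).mono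
      le_rfl fun τ ⟨hnat, hmem, hstored⟩ => ⟨hnat.trans hυ_nat, fun r hr => ?_, fun i hi => ?_⟩
    · exact (List.cons.inj (hes τ (hnat.trans hυ_nat) fun r hr =>
        (hmem r hr).trans (hυ_eq (hr.trans_le ha)))).2
    · exact (hmem r (haddr ▸ hr.trans (Nat.lt_succ_self _))).trans (hυ_eq hr)
    · cases i with
      | zero =>
        rw [add_zero, hmem _ (haddr ▸ Nat.lt_succ_self _), hυ_mem, Function.update_self]
        rfl
      | succ i =>
        have := hstored i (Nat.lt_of_succ_lt_succ hi)
        rwa [haddr, add_assoc, add_comm 1 i] at this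

/-! ### Expressions for complex numbers, data and alignments -/

/-- The product of an integer expression and a constant. -/
def NExp.scale (e : NExp) : ℕ → NExp
  | 0 => .const 0
  | m + 1 => .add (e.scale m) e

@[simp]
theorem NExp.eval_scale (σ : State) (e : NExp) (m : ℕ) : (e.scale m).eval σ = m * e.eval σ := by
  induction m with
  | zero => rw [scale, eval, zero_mul]
  | succ m ih => rw [scale, eval, ih, Nat.succ_mul]

namespace RExp

instance : Add RExp := ⟨add⟩
instance : Sub RExp := ⟨sub⟩
instance : Mul RExp := ⟨mul⟩
instance : Div RExp := ⟨div⟩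

/-- The absolute value of an expression. -/
def abs (e : RExp) : RExp := .sqrt (e * e)

variable (σ : State) (e f : RExp)

@[simp]
theorem eval_const (c : ℤ) : (const c).eval σ = c := rfl

@[simp]
theorem eval_add : (e + f).eval σ = e.eval σ + f.eval σ := rfl

@[simp]
theorem eval_sub : (e - f).eval σ = e.eval σ - f.eval σ := rfl

@[simp]
theorem eval_mul : (e * f).eval σ = e.eval σ * f.eval σ := rfl

@[simp]
theorem eval_div : (e / f).eval σ = e.eval σ / f.eval σ := rfl

@[simp]
theorem eval_sqrt : (sqrt e).eval σ = √(e.eval σ) := rfl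

@[simp]
theorem eval_abs : e.abs.eval σ = |e.eval σ| := Real.sqrt_mul_self_eq_abs _

end RExp

namespace BExp

/-- Equality of reals as a test. -/
def realEq (e f : RExp) : BExp := .and (.not (.realLt e f)) (.not (.realLt f e))

/-- Equality of integers as a test. -/
def natEq (e f : NExp) : BExp := .and (.not (.natLt e f)) (.not (.natLt f e))

theorem holds_realEq {σ : State} {e f : RExp} :
    (realEq e f).holds σ ↔ e.eval σ = f.eval σ := by
  rw [realEq, holds, holds, holds, holds, holds, not_lt, not_lt, and_comm, le_antisymm_iff]

theorem holds_natEq {σ : State} {e f : NExp} : (natEq e f).holds σ ↔ e.eval σ = f.eval σ := by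
  rw [natEq, holds, holds, holds, holds, holds, not_lt, not_lt, and_comm, le_antisymm_iff]

end BExp

/-- Expressions for the real and the imaginary part of a complex number. -/
structure CExp where
  re : RExp
  im : RExp

namespace CExp

/-- The complex number in a given state. -/
def eval (σ : State) (z : CExp) : ℂ := ⟨z.re.eval σ, z.im.eval σ⟩

instance : Add CExp := ⟨fun z w => ⟨z.re + w.re, z.im + w.im⟩⟩
instance : Sub CExp := ⟨fun z w => ⟨z.re - w.re, z.im - w.im⟩⟩
instance : Mul CExp := ⟨fun z w => ⟨z.re * w.re - z.im * w.im, z.re * w.im + z.im * w.re⟩⟩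
instance : SMul RExp CExp := ⟨fun e z => ⟨e * z.re, e * z.im⟩⟩

/-- The complex number with given integral real and imaginary parts. -/
def const (x y : ℤ) : CExp := ⟨.const x, .const y⟩

/-- The conjugate of an expression. -/
def star (z : CExp) : CExp := ⟨z.re, .const 0 - z.im⟩

/-- The inner product of the plane. -/
def inner (z w : CExp) : RExp := z.re * w.re + z.im * w.im

variable (σ : State) (z w : CExp)

@[simp]
theorem eval_add : (z + w).eval σ = z.eval σ + w.eval σ := rfl

@[simp]
theorem eval_mul : (z * w).eval σ = z.eval σ * w.eval σ := rfl

@[simp]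
theorem eval_smul (e : RExp) : (e • z).eval σ = e.eval σ • z.eval σ := by
  rw [Complex.real_smul]
  apply Complex.ext <;> simp [eval, HSMul.hSMul, SMul.smul]

@[simp]
theorem eval_const (x y : ℤ) : (const x y).eval σ = ⟨x, y⟩ := rfl

@[simp]
theorem eval_star : z.star.eval σ = conj (z.eval σ) := by
  apply Complex.ext <;> simp [eval, star]

@[simp]
theorem eval_inner : (z.inner w).eval σ = ⟪z.eval σ, w.eval σ⟫ := by
  rw [inner_eq_re_add_im]
  rfl

end CExp

theorem cos_arccos_eq (x : ℝ) : Real.cos (Real.arccos x) = (|x + 1| - |x - 1|) / 2 := by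
  rcases le_or_gt x (-1) with hx | hx
  · rw [Real.arccos_of_le_neg_one hx, Real.cos_pi, abs_of_nonpos (by linarith),
      abs_of_nonpos (by linarith)]
    ring
  rcases le_or_gt x 1 with hx' | hx'
  · rw [Real.cos_arccos hx.le hx', abs_of_nonneg (by linarith), abs_of_nonpos (by linarith)]
    ring
  · rw [Real.arccos_of_one_le hx'.le, Real.cos_zero, abs_of_nonneg (by linarith),
      abs_of_nonneg (by linarith)]
    ring

/-- Expressions for an affine form. -/
abbrev FormExp : Type := CExp × RExp

namespace FormExp

/-- The affine form in a given state. -/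
def eval (σ : State) (f : FormExp) : AffineForm := (f.1.eval σ, f.2.eval σ)

/-- The value of the form at a complex number. -/
def apply (f : FormExp) (z : CExp) : RExp := f.1.inner z - f.2

/-- The coordinates of `AffineForm.circleMinimizer`; the two coordinates of the second factor are
the cosine and, up to the sign `ε`, the sine of an `arccos`. -/
def circleMinimizer (f : FormExp) (ε : ℤ) : CExp :=
  let norm : RExp := .sqrt (f.1.inner f.1)
  let x : RExp := f.2 / norm
  ((.const 1 : RExp) / norm) • f.1 *
    ⟨((x + .const 1).abs - (x - .const 1).abs) / .const 2, .const ε * .sqrt (.const 1 - x * x)⟩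

variable (σ : State)

@[simp]
theorem eval_sub (f g : FormExp) : (f - g).eval σ = f.eval σ - g.eval σ := rfl

@[simp]
theorem eval_smul (e : RExp) (f : FormExp) : (e • f).eval σ = e.eval σ • f.eval σ :=
  Prod.ext (CExp.eval_smul σ f.1 e) rfl

@[simp]
theorem eval_apply (f : FormExp) (z : CExp) : (f.apply z).eval σ = (f.eval σ).eval (z.eval σ) := by
  rw [apply, RExp.eval_sub, CExp.eval_inner]
  rfl

theorem eval_circleMinimizer {f : FormExp} (hf : (f.eval σ).1 ≠ 0) {ε : ℤ} (hε : ε = 1 ∨ ε = -1) :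
    (f.circleMinimizer ε).eval σ = (f.eval σ).circleMinimizer ε := by
  have hnorm : √⟪f.1.eval σ, f.1.eval σ⟫ = ‖f.1.eval σ‖ := (norm_eq_sqrt_real_inner _).symm
  have hdirection : Complex.exp ((f.1.eval σ).arg * I) = ‖f.1.eval σ‖⁻¹ • f.1.eval σ := by
    rw [eq_inv_smul_iff₀ (norm_ne_zero_iff.2 (show f.1.eval σ ≠ 0 from hf)),
      Complex.real_smul, Complex.norm_mul_exp_arg_mul_I]
  rw [AffineForm.circleMinimizer, Circle.exp_add, Circle.coe_mul, Circle.coe_exp, Circle.coe_exp,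
    circleMinimizer, CExp.eval_mul, CExp.eval_smul]
  refine congrArg₂ (· * ·) ?_ (Complex.ext ?_ ?_)
  · rw [RExp.eval_div, RExp.eval_sqrt, CExp.eval_inner, hnorm, eval, hdirection, RExp.eval_const,
      Int.cast_one, one_div]
  · rw [Complex.exp_ofReal_mul_I_re]
    rcases hε with rfl | rfl <;> simp [CExp.eval, cos_arccos_eq, eval]
  · rw [Complex.exp_ofReal_mul_I_im]
    rcases hε with rfl | rfl <;> simp [CExp.eval, Real.sin_arccos, eval, sq]

end FormExp

/-- Expressions for a datum. -/
structure DatumExp where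
  point : CExp
  normal : CExp
  offset : RExp

namespace DatumExp

/-- The datum in a given state. -/
def eval (σ : State) (d : DatumExp) : Datum := ⟨d.point.eval σ, d.normal.eval σ, d.offset.eval σ⟩

/-- The input pair whose index is in register `r`. -/
def input (r : ℕ) : DatumExp :=
  let cell (i : ℕ) : RExp := .load (.add (.scale (.var r) 5) (.const i))
  ⟨⟨cell 0, cell 1⟩, ⟨cell 2, cell 3⟩, cell 4⟩

/-- The expression for `Datum.det`. -/
def det (d₁ d₂ : DatumExp) : RExp := (d₁.normal.star * d₂.normal).im

/-- The expression for `Datum.form`. -/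
def form (d : DatumExp) : FormExp := (d.normal * d.point.star, d.offset)

variable (σ : State) (d d₁ d₂ : DatumExp)

@[simp]
theorem eval_normal : (d.eval σ).normal = d.normal.eval σ := rfl

@[simp]
theorem eval_det : (d₁.det d₂).eval σ = (d₁.eval σ).det (d₂.eval σ) := by
  rw [Datum.det, eval_normal, eval_normal, ← CExp.eval_star, ← CExp.eval_mul]
  rfl

@[simp]
theorem eval_form : d.form.eval σ = (d.eval σ).form := by
  simp [FormExp.eval, form, Datum.form, eval]

end DatumExp

/-- Expressions for a frame. -/
structure FrameExp where
  fst : CExp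
  snd : CExp

namespace FrameExp

/-- The frame in a given state. -/
def eval (σ : State) (F : FrameExp) : Frame := ⟨F.fst.eval σ, F.snd.eval σ⟩

/-- The expression for `Frame.cross`. -/
def cross (d₁ d₂ : DatumExp) : FrameExp where
  fst := ((.const 1 : RExp) / d₁.det d₂) • (.const 0 (-1) * d₂.normal)
  snd := ((.const 1 : RExp) / d₁.det d₂) • (.const 0 1 * d₁.normal)

/-- The expression for `Frame.slide`. -/
def slide (d : DatumExp) : FrameExp where
  fst := ((.const 1 : RExp) / d.normal.inner d.normal) • d.normal
  snd := .const 0 0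

/-- The expression for `Frame.form`. -/
def form (F : FrameExp) (d₁ d₂ d₃ : DatumExp) : FormExp :=
  d₃.form - d₃.normal.inner F.fst • d₁.form - d₃.normal.inner F.snd • d₂.form

/-- The translation of the alignment `Frame.align` with rotation `ρ`. -/
def translation (F : FrameExp) (d₁ d₂ : DatumExp) (ρ : CExp) : CExp :=
  d₁.form.apply ρ • F.fst + d₂.form.apply ρ • F.snd

variable (σ : State) (F : FrameExp) (d d₁ d₂ d₃ : DatumExp)

theorem eval_cross : (cross d₁ d₂).eval σ = .cross (d₁.eval σ) (d₂.eval σ) := by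
  have hI : (⟨0, 1⟩ : ℂ) = I := rfl
  have hI' : (⟨0, -1⟩ : ℂ) = -I := by apply Complex.ext <;> simp
  simp [eval, cross, Frame.cross, hI, hI']

theorem eval_slide : (slide d).eval σ = .slide (d.eval σ) := by
  have h0 : (⟨0, 0⟩ : ℂ) = 0 := rfl
  simp [eval, slide, Frame.slide, h0]

theorem eval_form : (F.form d₁ d₂ d₃).eval σ =
    (F.eval σ).form (d₁.eval σ) (d₂.eval σ) (d₃.eval σ) := by
  simp [form, Frame.form, eval]

theorem eval_translation (ρ : CExp) {ρ' : Circle} (hρ : ρ.eval σ = ρ') :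
    (F.translation d₁ d₂ ρ).eval σ =
      toComplex ((F.eval σ).align (d₁.eval σ) (d₂.eval σ) ρ').2 := by
  simp [translation, Frame.align, eval, hρ]

end FrameExp

/-! ### The output as a list -/

/-- A selection from `candidates d₁ d₂ d₃` as a list. -/
def chosen (d₁ d₂ d₃ : Datum) : List Alignment :=
  open Classical in
  if d₁.det d₂ = 0 then
    ((Frame.slide d₁).form d₁ d₂ d₂).circleMinimizers.map ((Frame.slide d₁).align d₁ d₂)
  else ((Frame.cross d₁ d₂).form d₁ d₂ d₃).circleMinimizers.map ((Frame.cross d₁ d₂).align d₁ d₂)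

theorem isSelectionPerRotation_chosen {d₁ : Datum} (h₁ : d₁.normal ≠ 0) (d₂ d₃ : Datum) :
    IsSelectionPerRotation (candidates d₁ d₂ d₃) {a | a ∈ chosen d₁ d₂ d₃} := by
  rw [candidates, chosen]
  split_ifs with hdet
  · exact (Frame.reduces_slide h₁ hdet).isSelectionPerRotation_map_circleMinimizers
  · exact (Frame.reduces_cross hdet d₃).isSelectionPerRotation_map_circleMinimizers

/-- The alignments that the program chooses for the triple `(j, k, l)`. -/
def tripleList (D : ℕ → Datum) (j k l : ℕ) : List Alignment :=
  if j = k then [] else chosen (D j) (D k) (D l)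

/-- The output of the program for the data `D i`, `i < n`. -/
def outputList (D : ℕ → Datum) (n : ℕ) : List Alignment :=
  (List.range n).flatMap fun j => (List.range n).flatMap fun k => (List.range n).flatMap fun l =>
    tripleList D j k l

theorem mem_outputList_iff {D : ℕ → Datum} {n : ℕ} {a : Alignment} :
    a ∈ outputList D n ↔ ∃ j k l : Fin n, j ≠ k ∧ a ∈ chosen (D j) (D k) (D l) := by
  simp only [outputList, tripleList, List.mem_flatMap, List.mem_range, Fin.exists_iff, ne_eq,
    Fin.mk.injEq, exists_prop, List.mem_ite_nil_left]

theorem isAlignOutput_outputList {n : ℕ} {p : Fin n → Plane} {ℓ : Fin n → AffineSubspace ℝ Plane}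
    {D : ℕ → Datum} (hD : ∀ i : Fin n, (D i).Describes (p i) (ℓ i)) :
    IsAlignOutput p ℓ {a | a ∈ outputList D n} :=
  (isAlignOutput_iff hD).2 ⟨fun j k l => {a | a ∈ chosen (D j) (D k) (D l)},
    fun j k l _ => isSelectionPerRotation_chosen (hD j).normal_ne_zero (D k) (D l),
    Set.ext fun _ => mem_outputList_iff⟩

/-! ### The program -/

/-- Append the alignment with the given rotation and translation to the output. Register `0` holds
`n`, register `4` the length of the output, which is stored right after the input. -/
def emit (ρ t : CExp) : Prog :=
  .seq (storeList (.add (.scale (.var 0) 5) (.scale (.var 4) 6))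
      [ρ.re, .const 0 - ρ.im, ρ.im, ρ.re, t.re, t.im])
    (.setNat 4 (.add (.var 4) (.const 1)))

/-- Append the alignment `Frame.align` with rotation `ρ` to the output. -/
def FrameExp.emitAlign (F : FrameExp) (d₁ d₂ : DatumExp) (ρ : CExp) : Prog :=
  emit ρ (F.translation d₁ d₂ ρ)

/-- Append the alignments `Frame.align` for the rotations in `AffineForm.circleMinimizers` to the
output. -/
def FrameExp.emitMinimizers (F : FrameExp) (d₁ d₂ : DatumExp) (f : FormExp) : Prog :=
  .cond (.realEq (f.1.inner f.1) (.const 0)) (F.emitAlign d₁ d₂ (.const 1 0)) <|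
    .seq (F.emitAlign d₁ d₂ (f.circleMinimizer 1)) (F.emitAlign d₁ d₂ (f.circleMinimizer (-1)))

/-- Append `tripleList` to the output, where the indices are in the registers `1`, `2`, `3`. -/
def tripleProg : Prog :=
  let d₁ := DatumExp.input 1
  let d₂ := DatumExp.input 2
  let d₃ := DatumExp.input 3
  .cond (.natEq (.var 1) (.var 2)) .skip <|
  .cond (.realEq (d₁.det d₂) (.const 0))
    ((FrameExp.slide d₁).emitMinimizers d₁ d₂ ((FrameExp.slide d₁).form d₁ d₂ d₂))
    ((FrameExp.cross d₁ d₂).emitMinimizers d₁ d₂ ((FrameExp.cross d₁ d₂).form d₁ d₂ d₃))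

/-- The program of the theorem: its output is `outputList`. -/
def alignProg : Prog :=
  .seq (.setNat 4 (.const 0)) <| .seq (forLoop 1 (forLoop 2 (forLoop 3 tripleProg))) <|
    .seq (.setNat 1 (.scale (.var 0) 5)) (.setNat 0 (.var 4))

/-! ### Correctness of the program -/

/-- The six numbers that represent an alignment in the output. -/
def Alignment.entries (a : Alignment) : List ℝ :=
  [a.1.1 0 0, a.1.1 0 1, a.1.1 1 0, a.1.1 1 1, a.2 0, a.2 1]

/-- The input pair with index `i`. -/
def State.datum (σ : State) (i : ℕ) : Datum where
  point := ⟨σ.mem (5 * i), σ.mem (5 * i + 1)⟩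
  normal := ⟨σ.mem (5 * i + 2), σ.mem (5 * i + 3)⟩
  offset := σ.mem (5 * i + 4)

/-- The input cells of `τ` are those of `σ₀`, and the registers up to `i` are given by `s`. -/
structure Reads (σ₀ : State) (i : ℕ) (s : ℕ → ℕ) (τ : State) : Prop where
  reg_eq : ∀ r ≤ i, τ.nat r = s r
  mem_eq : ∀ r < 5 * s 0, τ.mem r = σ₀.mem r

/-- The output of `τ` is `L`, stored from address `q` on. -/
structure Writes (q : ℕ) (L : List Alignment) (τ : State) : Prop where
  count_eq : τ.nat 4 = L.length
  stored : ∀ m (hm : m < L.length), Stored τ.mem (q + 6 * m) L[m].entries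

/-- The program appends `L` to the output in at most `K` steps, and it keeps the input and the
registers up to `i`, which are given by `s`. -/
def Appends (σ₀ : State) (i : ℕ) (s : ℕ → ℕ) (c : Prog) (K : ℕ) (L : List Alignment) : Prop :=
  ∀ σ M, Reads σ₀ i s σ → Writes (5 * s 0) M σ →
    Runs c σ K fun τ => Reads σ₀ i s τ ∧ Writes (5 * s 0) (M ++ L) τ

theorem DatumExp.eval_input (σ : State) (r : ℕ) : (input r).eval σ = σ.datum (σ.nat r) := by
  simp only [eval, input, State.datum, CExp.eval, RExp.eval, NExp.eval, NExp.eval_scale, add_zero]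

variable {σ₀ : State} {i : ℕ} {s : ℕ → ℕ}

theorem Reads.eval_input {τ : State} (h : Reads σ₀ i s τ) {r : ℕ} (hr : r ≤ i) (hlt : s r < s 0) :
    (DatumExp.input r).eval τ = σ₀.datum (s r) := by
  rw [DatumExp.eval_input, h.reg_eq r hr, State.datum, State.datum, h.mem_eq _ (by omega),
    h.mem_eq _ (by omega), h.mem_eq _ (by omega), h.mem_eq _ (by omega), h.mem_eq _ (by omega)]

theorem Reads.setNat {τ : State} (h : Reads σ₀ i s τ) {r : ℕ} (hr : i < r) (x : ℕ) :
    Reads σ₀ i s { τ with nat := Function.update τ.nat r x } where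
  reg_eq m hm := (Function.update_of_ne (hm.trans_lt hr).ne _ _).trans (h.reg_eq m hm)
  mem_eq := h.mem_eq

theorem Writes.setNat {q : ℕ} {L : List Alignment} {τ : State} (h : Writes q L τ) {r : ℕ}
    (hr : r < 4) (x : ℕ) : Writes q L { τ with nat := Function.update τ.nat r x } where
  count_eq := (Function.update_of_ne hr.ne' _ _).trans h.count_eq
  stored := h.stored

theorem Writes.append {q : ℕ} {M : List Alignment} {a : Alignment} {σ τ : State}
    (h : Writes q M σ) (hcount : τ.nat 4 = σ.nat 4 + 1)
    (hmem : ∀ r < q + 6 * M.length, τ.mem r = σ.mem r)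
    (ha : Stored τ.mem (q + 6 * M.length) a.entries) : Writes q (M ++ [a]) τ where
  count_eq := by rw [hcount, h.count_eq, List.length_append, List.length_singleton]
  stored m hm := by
    rcases lt_or_ge m M.length with hlt | hge
    · rw [List.getElem_append_left hlt]
      refine (h.stored m hlt).congr fun r hr => hmem r ?_
      rw [Alignment.entries] at hr
      simp only [List.length_cons, List.length_nil] at hr
      omega
    · obtain rfl : m = M.length := by
        rw [List.length_append, List.length_singleton] at hm
        omega
      rwa [List.getElem_concat_length rfl]

namespace Appends

theorem skip : Appends σ₀ i s .skip 1 [] := fun _ M hσ hM =>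
  .skip ⟨hσ, M.append_nil.symm ▸ hM⟩

theorem seq {c d : Prog} {K₁ K₂ : ℕ} {L₁ L₂ : List Alignment} (hc : Appends σ₀ i s c K₁ L₁)
    (hd : Appends σ₀ i s d K₂ L₂) : Appends σ₀ i s (.seq c d) (K₁ + K₂) (L₁ ++ L₂) :=
  fun σ M hσ hM => (hc σ M hσ hM).seq fun τ ⟨hτ, hM'⟩ =>
    List.append_assoc M L₁ L₂ ▸ hd τ _ hτ hM'

theorem cond {t : BExp} {c d : Prog} {K₁ K₂ : ℕ} {L₁ L₂ : List Alignment} {P : Prop} [Decidable P]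
    (ht : ∀ τ, Reads σ₀ i s τ → (t.holds τ ↔ P)) (hc : P → Appends σ₀ i s c K₁ L₁)
    (hd : ¬ P → Appends σ₀ i s d K₂ L₂) :
    Appends σ₀ i s (.cond t c d) (t.cost + max K₁ K₂) (if P then L₁ else L₂) := by
  intro σ M hσ hM
  refine .cond (fun h => ?_) (fun h => ?_) <;> rw [ht σ hσ] at h
  · rw [if_pos h]
    exact hc h σ M hσ hM
  · rw [if_neg h]
    exact hd h σ M hσ hM

theorem emit {ρ t : CExp} {a : Alignment} (hi : i ≤ 3)
    (hρ : ∀ τ, Reads σ₀ i s τ → ρ.eval τ = a.rot)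
    (ht : ∀ τ, Reads σ₀ i s τ → t.eval τ = toComplex a.2) :
    Appends σ₀ i s (emit ρ t) (emit ρ t).bound [a] := by
  intro σ M hσ hM
  have haddr : (NExp.add (.scale (.var 0) 5) (.scale (.var 4) 6)).eval σ =
      5 * s 0 + 6 * M.length := by
    rw [NExp.eval, NExp.eval_scale, NExp.eval_scale, NExp.eval, NExp.eval, hM.count_eq,
      hσ.reg_eq 0 i.zero_le]
  have reads {τ : State} (hnat : τ.nat = σ.nat) (hmem : ∀ r < 5 * s 0, τ.mem r = σ.mem r) :
      Reads σ₀ i s τ :=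
    ⟨fun r hr => hnat ▸ hσ.reg_eq r hr, fun r hr => (hmem r hr).trans (hσ.mem_eq r hr)⟩
  refine .seq (.storeList _ a.entries (q := 5 * s 0) (haddr ▸ Nat.le_add_right _ _) ?_) ?_
  · intro τ hnat hmem
    obtain ⟨hre, him⟩ := Complex.ext_iff.1 (hρ τ (reads hnat hmem))
    obtain ⟨hre', him'⟩ := Complex.ext_iff.1 (ht τ (reads hnat hmem))
    simp only [CExp.eval, toComplex_re, toComplex_im] at hre him hre' him'
    simp [Alignment.entries, a.coe_fst, hre, him, hre', him']
  · rw [haddr]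
    rintro τ ⟨hnat, hmem, hstored⟩
    refine .setNat ⟨(reads hnat fun r hr => hmem r (hr.trans_le (Nat.le_add_right _ _))).setNat
      (Nat.lt_succ_of_le hi) _, hM.append ?_ hmem hstored⟩
    rw [← hnat]
    exact Function.update_self 4 (τ.nat 4 + 1) τ.nat

theorem forLoop {c : Prog} {K : ℕ} {L : ℕ → List Alignment} (hi : i < 3)
    (hc : ∀ x < s 0, Appends σ₀ (i + 1) (Function.update s (i + 1) x) c K (L x)) :
    Appends σ₀ i s (forLoop (i + 1) c) (s 0 * (K + 7) + 5) ((List.range (s 0)).flatMap L) := by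
  intro σ M hσ hM
  let P (m : ℕ) (τ : State) : Prop := Reads σ₀ i s τ ∧ τ.nat (i + 1) = m ∧
    Writes (5 * s 0) (M ++ (List.range m).flatMap L) τ
  have test_iff (m : ℕ) (τ : State) (hτ : P m τ) :
      (BExp.natLt (.var (i + 1)) (.var 0)).holds τ ↔ m < s 0 := by
    rw [BExp.holds, NExp.eval, NExp.eval, hτ.2.1, hτ.1.reg_eq 0 i.zero_le]
  have body (m : ℕ) (hm : m < s 0) (τ : State) (hτ : P m τ) :
      Runs (.seq c (.setNat (i + 1) (.add (.var (i + 1)) (.const 1)))) τ (K + 4) (P (m + 1)) := by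
    obtain ⟨hreads, hreg, hwrites⟩ := hτ
    have hs₀ : Function.update s (i + 1) m 0 = s 0 := Function.update_of_ne i.succ_ne_zero.symm _ _
    have hs {r : ℕ} (hr : r ≤ i) : Function.update s (i + 1) m r = s r :=
      Function.update_of_ne (Nat.lt_succ_of_le hr).ne _ _
    have hreads' : Reads σ₀ (i + 1) (Function.update s (i + 1) m) τ := by
      refine ⟨fun r hr => ?_, hs₀.symm ▸ hreads.mem_eq⟩
      rcases Nat.le_succ_iff.1 hr with hr | rfl
      · rw [hs hr, hreads.reg_eq r hr]
      · rw [Function.update_self, hreg]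
    refine (hc m hm τ _ hreads' (hs₀.symm ▸ hwrites)).seq fun υ ⟨hυ, hυ'⟩ => .setNat ?_
    rw [hs₀] at hυ'
    have hυ_reg : υ.nat (i + 1) = m := (hυ.reg_eq _ le_rfl).trans (Function.update_self _ _ _)
    refine ⟨Reads.setNat ⟨fun r hr => (hυ.reg_eq r (Nat.le_succ_of_le hr)).trans (hs hr),
      hs₀ ▸ hυ.mem_eq⟩ i.lt_succ_self _, ?_, ?_⟩
    · exact (Function.update_self _ _ _).trans (congrArg (· + 1) hυ_reg)
    · rw [List.range_succ, List.flatMap_append, List.flatMap_singleton, ← List.append_assoc]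
      exact hυ'.setNat (Nat.succ_lt_succ hi) _
  have init : Runs (.setNat (i + 1) (.const 0)) σ 2 (P 0) :=
    .setNat ⟨hσ.setNat i.lt_succ_self _, Function.update_self _ _ _,
      M.append_nil.symm ▸ hM.setNat (Nat.succ_lt_succ hi) _⟩
  refine (init.seq fun τ hτ => .loop_of_forall_lt P test_iff body (s 0).zero_le hτ).mono ?_
    fun τ hτ => ⟨hτ.1, hτ.2.2⟩
  rw [Nat.sub_zero, show (BExp.natLt (.var (i + 1)) (.var 0)).cost = 3 from rfl]
  linarith

variable {F : FrameExp} {F' : Frame} {d₁ d₂ : DatumExp} {e₁ e₂ : Datum}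

theorem emitAlign {ρ : CExp} {ρ' : Circle} (hi : i ≤ 3) (hF : ∀ τ, Reads σ₀ i s τ → F.eval τ = F')
    (hd₁ : ∀ τ, Reads σ₀ i s τ → d₁.eval τ = e₁) (hd₂ : ∀ τ, Reads σ₀ i s τ → d₂.eval τ = e₂)
    (hρ : ∀ τ, Reads σ₀ i s τ → ρ.eval τ = ρ') :
    Appends σ₀ i s (F.emitAlign d₁ d₂ ρ) (F.emitAlign d₁ d₂ ρ).bound [F'.align e₁ e₂ ρ'] := by
  refine emit hi (fun τ hτ => ?_) fun τ hτ => ?_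
  · rw [hρ τ hτ, Frame.rot_align]
  · rw [FrameExp.eval_translation τ F d₁ d₂ ρ (hρ τ hτ), hF τ hτ, hd₁ τ hτ, hd₂ τ hτ]

theorem emitMinimizers {f : FormExp} {f' : AffineForm} (hi : i ≤ 3)
    (hF : ∀ τ, Reads σ₀ i s τ → F.eval τ = F') (hd₁ : ∀ τ, Reads σ₀ i s τ → d₁.eval τ = e₁)
    (hd₂ : ∀ τ, Reads σ₀ i s τ → d₂.eval τ = e₂) (hf : ∀ τ, Reads σ₀ i s τ → f.eval τ = f') :
    Appends σ₀ i s (F.emitMinimizers d₁ d₂ f) (F.emitMinimizers d₁ d₂ f).bound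
      (f'.circleMinimizers.map (F'.align e₁ e₂)) := by
  rw [AffineForm.circleMinimizers, apply_ite (List.map _)]
  refine cond (fun τ hτ => ?_) (fun _ => ?_) (fun hne => ?_)
  · rw [BExp.holds_realEq, CExp.eval_inner, RExp.eval_const, Int.cast_zero, inner_self_eq_zero,
      ← hf τ hτ]
    rfl
  · refine emitAlign hi hF hd₁ hd₂ fun _ _ => ?_
    apply Complex.ext <;> simp
  · have eval_minimizer {ε : ℤ} (hε : ε = 1 ∨ ε = -1) (τ : State) (hτ : Reads σ₀ i s τ) :
        (f.circleMinimizer ε).eval τ = f'.circleMinimizer ε := by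
      rw [← hf τ hτ] at hne ⊢
      exact FormExp.eval_circleMinimizer τ hne hε
    exact_mod_cast (emitAlign hi hF hd₁ hd₂ (eval_minimizer (.inl rfl))).seq
      (emitAlign hi hF hd₁ hd₂ (eval_minimizer (.inr rfl)))

theorem tripleProg (h₁ : s 1 < s 0) (h₂ : s 2 < s 0) (h₃ : s 3 < s 0) :
    Appends σ₀ 3 s tripleProg tripleProg.bound (tripleList σ₀.datum (s 1) (s 2) (s 3)) := by
  have eval₁ (τ : State) (hτ : Reads σ₀ 3 s τ) := hτ.eval_input (by norm_num) h₁
  have eval₂ (τ : State) (hτ : Reads σ₀ 3 s τ) := hτ.eval_input (by norm_num) h₂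
  have eval₃ (τ : State) (hτ : Reads σ₀ 3 s τ) := hτ.eval_input le_rfl h₃
  rw [tripleList, chosen]
  refine cond (fun τ hτ => ?_) (fun _ => skip) fun _ => cond (fun τ hτ => ?_)
    (fun _ => emitMinimizers le_rfl (fun τ hτ => ?_) eval₁ eval₂ fun τ hτ => ?_)
    (fun _ => emitMinimizers le_rfl (fun τ hτ => ?_) eval₁ eval₂ fun τ hτ => ?_)
  · rw [BExp.holds_natEq, NExp.eval, NExp.eval, hτ.reg_eq 1 (by norm_num),
      hτ.reg_eq 2 (by norm_num)]
  · rw [BExp.holds_realEq, DatumExp.eval_det, RExp.eval_const, Int.cast_zero, eval₁ τ hτ,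
      eval₂ τ hτ]
  · rw [FrameExp.eval_slide, eval₁ τ hτ]
  · rw [FrameExp.eval_form, FrameExp.eval_slide, eval₁ τ hτ, eval₂ τ hτ]
  · rw [FrameExp.eval_cross, eval₁ τ hτ, eval₂ τ hτ]
  · rw [FrameExp.eval_form, FrameExp.eval_cross, eval₁ τ hτ, eval₂ τ hτ, eval₃ τ hτ]

end Appends

theorem Writes.holdsOutput {q : ℕ} {L : List Alignment} {σ : State} (h : Writes q L σ)
    (hstart : σ.nat 1 = q) (hcount : σ.nat 0 = σ.nat 4) : HoldsOutput σ {a | a ∈ L} := by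
  subst hstart
  have hlength : σ.nat 0 = L.length := hcount.trans h.count_eq
  refine ⟨fun i => L.get (Fin.cast hlength i), ?_, fun i => ?_⟩
  · ext a
    rw [Set.mem_ofPred_eq, List.mem_iff_get, Set.mem_range]
    exact (finCongr hlength).surjective.exists
  · have hi := h.stored i (hlength ▸ i.2)
    simp only [Stored, Alignment.entries] at hi
    exact ⟨hi 0 (by simp), hi 1 (by simp), hi 2 (by simp), hi 3 (by simp), hi 4 (by simp),
      hi 5 (by simp)⟩

theorem alignProg_runs {n : ℕ} (hn : 1 ≤ n) {σ : State} (hσ : σ.nat 0 = n) :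
    Runs alignProg σ ((tripleProg.bound + 60) * n ^ 3) fun τ =>
      HoldsOutput τ {a | a ∈ outputList σ.datum n} := by
  subst hσ
  have loops : Appends σ 0 σ.nat (forLoop 1 (forLoop 2 (forLoop 3 tripleProg)))
      (σ.nat 0 * (σ.nat 0 * (σ.nat 0 * (tripleProg.bound + 7) + 5 + 7) + 5 + 7) + 5)
      (outputList σ.datum (σ.nat 0)) :=
    .forLoop (by norm_num) fun j hj => .forLoop (by norm_num) fun k hk =>
      .forLoop (by norm_num) fun l hl => .tripleProg hj hk hl
  have init : Runs (.setNat 4 (.const 0)) σ 2 fun τ =>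
      Reads σ 0 σ.nat τ ∧ Writes (5 * σ.nat 0) [] τ :=
    .setNat ⟨.setNat ⟨fun _ _ => rfl, fun _ _ => rfl⟩ (by norm_num) _,
      Function.update_self 4 0 σ.nat, fun m hm => absurd hm (Nat.not_lt_zero m)⟩
  have final (τ : State) (hτ : Reads σ 0 σ.nat τ ∧
      Writes (5 * σ.nat 0) ([] ++ outputList σ.datum (σ.nat 0)) τ) :
      Runs (.seq (.setNat 1 (.scale (.var 0) 5)) (.setNat 0 (.var 4))) τ 14 fun υ =>
        HoldsOutput υ {a | a ∈ outputList σ.datum (σ.nat 0)} := by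
    have hstart : (NExp.scale (.var 0) 5).eval τ = 5 * σ.nat 0 := by
      rw [NExp.eval_scale, NExp.eval, hτ.1.reg_eq 0 le_rfl]
    refine .seq (K₁ := 12) (K₂ := 2) (Q := (· = _)) (.setNat rfl) ?_
    rintro _ rfl
    refine .setNat <|
      ((hτ.2.setNat (r := 1) (by norm_num) _).setNat (r := 0) (by norm_num) _).holdsOutput ?_ ?_
    · simpa using hstart
    · simp [NExp.eval]
  refine (init.seq fun τ hτ => (loops τ [] hτ.1 hτ.2).seq final).mono ?_ fun _ => id
  nlinarith [Nat.one_le_pow 3 _ hn, Nat.pow_le_pow_right hn (show 2 ≤ 3 by norm_num),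
    Nat.pow_le_pow_right hn (show 1 ≤ 3 by norm_num)]

theorem IsLine.normal_ne_zero {ℓ : AffineSubspace ℝ Plane} (hℓ : IsLine ℓ) {ν : ℂ} {γ : ℝ}
    (h : ∀ q, q ∈ ℓ ↔ ⟪ν, toComplex q⟫ = γ) : ν ≠ 0 := by
  rintro rfl
  simp only [inner_zero_left] at h
  rw [IsLine] at hℓ
  rcases eq_or_ne 0 γ with hγ | hγ
  · have : ℓ = ⊤ := by
      ext q
      simp [h, hγ]
    rw [this, AffineSubspace.direction_top, finrank_top, finrank_euclideanSpace_fin] at hℓ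
    omega
  · have : ℓ = ⊥ := by
      ext q
      simp [h, hγ, AffineSubspace.notMem_bot]
    rw [this, AffineSubspace.direction_bot, finrank_bot] at hℓ
    omega

theorem HoldsInput.describes {n : ℕ} {σ : State} {p : Fin n → Plane}
    {ℓ : Fin n → AffineSubspace ℝ Plane} (h : HoldsInput σ p ℓ) (hℓ : ∀ i, IsLine (ℓ i))
    (i : Fin n) : (σ.datum i).Describes (p i) (ℓ i) := by
  obtain ⟨hre, him, hline⟩ := h.2 i
  have mem_line_iff (q : Plane) :
      q ∈ ℓ i ↔ ⟪(σ.datum i).normal, toComplex q⟫ = (σ.datum i).offset := by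
    rw [← SetLike.mem_coe, hline, Set.mem_ofPred_eq, inner_eq_re_add_im, toComplex_re,
      toComplex_im, State.datum]
  refine ⟨Complex.ext ?_ ?_, (hℓ i).normal_ne_zero mem_line_iff, mem_line_iff⟩
  · rw [toComplex_re, ← hre, State.datum]
  · rw [toComplex_im, ← him, State.datum]

end PointsToLines

end

theorem mainTheorem2 :
    ∃ K : ℕ,
      (∀ (n : ℕ), 3 ≤ n →
        ∀ (p : Fin n → PointsToLines.Plane) (ℓ : Fin n → AffineSubspace ℝ PointsToLines.Plane),
          (∀ i, PointsToLines.IsLine (ℓ i)) →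
          ∀ C : Set PointsToLines.Alignment, PointsToLines.IsAlignOutput p ℓ C →
            (∀ a' : PointsToLines.Alignment, ∃ a ∈ C, ∀ i,
              PointsToLines.lineDist (a.app (p i)) (ℓ i) ≤
                16 * PointsToLines.lineDist (a'.app (p i)) (ℓ i)) ∧
            C.Finite ∧ C.ncard ≤ K * n ^ 3) ∧
      (∃ c : PointsToLines.Prog, ∀ (n : ℕ), 3 ≤ n →
        ∀ (p : Fin n → PointsToLines.Plane) (ℓ : Fin n → AffineSubspace ℝ PointsToLines.Plane),
          (∀ i, PointsToLines.IsLine (ℓ i)) →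
          ∀ σ : PointsToLines.State, PointsToLines.HoldsInput σ p ℓ →
            ∃ (k : ℕ) (σ' : PointsToLines.State) (C : Set PointsToLines.Alignment),
              PointsToLines.Exec c σ k σ' ∧ k ≤ K * n ^ 3 ∧
              PointsToLines.IsAlignOutput p ℓ C ∧ PointsToLines.HoldsOutput σ' C) := by
  refine ⟨PointsToLines.tripleProg.bound + 60, fun n hn p ℓ _ C hC => ?_,
    PointsToLines.alignProg, fun n hn p ℓ hℓ σ hσ => ?_⟩
  · obtain ⟨hfinite, hcard⟩ := hC.finite_and_ncard_le
    exact ⟨hC.exists_lineDist_le (by omega), hfinite,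
      hcard.trans (Nat.mul_le_mul_right _ (by omega))⟩
  · obtain ⟨k, τ, hexec, hk, hout⟩ := PointsToLines.alignProg_runs (by omega) hσ.1
    exact ⟨k, τ, _, hexec, hk,
      PointsToLines.isAlignOutput_outputList fun i => hσ.describes hℓ i, hout⟩
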